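/- All sets are finite. An implicational base $\Sigma$ on a ground set $X$ is a set of implications $A\to b$ with $A\subseteq X$, $b\in X$. A set $S\subseteq X$ is closed if $b\in S$ whenever $A\to b\in\Sigma$ and $A\subseteq S$; $\mathcal C_\Sigma$ is the family of closed sets, $\phi(S)$ is the smallest closed set containing $S$, and $\mathcal L_\Sigma=(\mathcal C_\Sigma,\subseteq)$ is a lattice with meet $C\cap D$ and join $\phi(C\cup D)$. The closure space is standard if $\phi(\emptyset)=\emptyset$ and $\phi(\{x\})\setminus\{x\}$ is closed for all $x\in X$. The base $\Sigma$ is acyclic if the directed graph on $X$ with an arc $x\to y$ whenever $x\in A$ for some $A\to y\in\Sigma$ has no directed cycle. The closure space of $\Sigma$ is an acyclic convex geometry if it is standard and $\mathcal C_\Sigma=\mathcal C_{\Sigma'}$ for some acyclic implicational base $\Sigma'$. A meet-irreducible element of $\mathcal C_\Sigma$ is a closed set $M\ne X$ such that $M=C_1\cap C_2$ with $C_1,C_2\in\mathcal C_\Sigma$ implies $C_1=M$ or $C_2=M$; $\mathcal M(\mathcal C_\Sigma)$ is the set of these. Two antichains $\mathcal B^+,\mathcal B^-$ of $\mathcal L_\Sigma$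 are dual if $\downarrow\mathcal B^+\cap\uparrow\mathcal B^-=\emptyset$ and $\downarrow\mathcal B^+\cup\uparrow\mathcal B^-=\mathcal C_\Sigma$, where $\downarrow\mathcal B^+$ (resp. $\uparrow\mathcal B^-$) is the set of closed sets contained in a member of $\mathcal B^+$ (resp. containing a member of $\mathcal B^-$). CMI in acyclic convex geometries is the problem: given $X$, an implicational base $\Sigma$ on $X$ whose closure space is an acyclic convex geometry, and a family $\mathcal M\subseteq 2^X$, is $\mathcal M=\mathcal M(\mathcal C_\Sigma)$? Dualization in distributive lattices is the problem: given $X$, an implicational base $\Sigma$ on $X$ whose closure space is standard and whose lattice $\mathcal L_\Sigma$ is distributive, and two antichains $\mathcal B^+,\mathcal B^-$ of $\mathcal L_\Sigma$, are $\mathcal B^+$ and $\mathcal B^-$ dual in $\mathcal L_\Sigma$? (The lattice itself is not part of the input.) **Theorem.** If there is a polynomial-time algorithm solving CMI in acyclic convex geometries, then there is a polynomial-time algorithm solving dualization in distributive lattices. Moreover, let $\Sigma$ be any implicational base on a finite set $X$, let $\mathcal B^+,\mathcal B^-$ be antichains of $\mathcal L_\Sigma$, let $z\notin X$, and let $\Omega$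 be the implicational base on $X\cup\{z\}$ obtained from $\Sigma$ by adding the implication $A\to z$ for every $A\in\mathcal B^-$. If $\Sigma$ is acyclic, then so is $\Omega$; and $\mathcal B^+$ and $\mathcal B^-$ are dual in $\mathcal L_\Sigma$ if and only if $$\mathcal M(\mathcal C_\Omega)=\{M\cup\{z\}\mid M\in\mathcal M(\mathcal C_\Sigma)\}\cup\mathcal B^+ .$$ -/

import Mathlib

/-! ## Implicational bases, closure systems, meet-irreducible elements -/

/-- A (unit) implicational base on the finite ground set `α`: a set of implications `A → b`, where
the premise `A` is a subset of the ground set and the conclusion `b` is an element of it. -/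
abbrev ImplBase (α : Type*) : Type _ := Set (Finset α × α)

namespace ImplBase

section

variable {α : Type*}

/-- `S` is closed in the base: for every implication `A → b`, if `A ⊆ S` then `b ∈ S`. -/
def IsClosedSet (T : ImplBase α) (S : Finset α) : Prop :=
  ∀ p ∈ T, p.1 ⊆ S → p.2 ∈ S

/-- The closure system of the base: the family of its closed sets. -/
def closedSets (T : ImplBase α) : Set (Finset α) :=
  {S | T.IsClosedSet S}

open Classical in
/-- The closure operator of the base: the smallest closed set containing `S`, that is, the
intersection of all the closed sets containing `S`. -/
noncomputable def closure [Fintype α] (T : ImplBase α) (S : Finset α) : Finset α :=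
  Finset.univ.filter fun x => ∀ C ∈ T.closedSets, S ⊆ C → x ∈ C

/-- The closure space of the base is standard: the empty set is closed, and `φ(x) ∖ {x}` is closed
for every element `x`. -/
def IsStandard [Fintype α] [DecidableEq α] (T : ImplBase α) : Prop :=
  T.closure ∅ = ∅ ∧ ∀ x : α, (T.closure {x}).erase x ∈ T.closedSets

/-- The arcs of the implication-graph: from `x` to `y` when some implication `A → y` has `x ∈ A`. -/
def Arc (T : ImplBase α) (x y : α) : Prop :=
  ∃ A : Finset α, (A, y) ∈ T ∧ x ∈ A

/-- The base is acyclic: its implication-graph has no directed cycle. -/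
def IsAcyclic (T : ImplBase α) : Prop :=
  ∀ x : α, ¬ Relation.TransGen T.Arc x x

/-- The closure space of the base is an acyclic convex geometry: it is standard, and it admits an
acyclic implicational base (which need not be the given one). -/
def IsAcyclicConvexGeometry [Fintype α] [DecidableEq α] (T : ImplBase α) : Prop :=
  T.IsStandard ∧ ∃ T' : ImplBase α, T'.IsAcyclic ∧ T'.closedSets = T.closedSets

/-- The lattice of closed sets, with meet `C ∩ D` and join `φ(C ∪ D)`, is distributive. -/
def IsDistributive [Fintype α] [DecidableEq α] (T : ImplBase α) : Prop :=
  ∀ A ∈ T.closedSets, ∀ B ∈ T.closedSets, ∀ C ∈ T.closedSets,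
    A ∩ T.closure (B ∪ C) = T.closure ((A ∩ B) ∪ (A ∩ C))

/-- The set of meet-irreducible elements of the closure system: the closed sets `M`, other than the
whole ground set, that are not the intersection of two closed sets both different from `M`. -/
def meetIrreducibles [Fintype α] [DecidableEq α] (T : ImplBase α) : Set (Finset α) :=
  {M | M ∈ T.closedSets ∧ M ≠ Finset.univ ∧
    ∀ C₁ ∈ T.closedSets, ∀ C₂ ∈ T.closedSets, M = C₁ ∩ C₂ → C₁ = M ∨ C₂ = M}

/-- `B` is an antichain of the lattice of closed sets. -/
def IsAntichainOf (T : ImplBase α) (B : Set (Finset α)) : Prop :=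
  B ⊆ T.closedSets ∧ IsAntichain (· ⊆ ·) B

/-- The ideal `↓ B` in the lattice of closed sets. -/
def ideal (T : ImplBase α) (B : Set (Finset α)) : Set (Finset α) :=
  {F | F ∈ T.closedSets ∧ ∃ M ∈ B, F ⊆ M}

/-- The filter `↑ B` in the lattice of closed sets. -/
def upFilter (T : ImplBase α) (B : Set (Finset α)) : Set (Finset α) :=
  {F | F ∈ T.closedSets ∧ ∃ A ∈ B, A ⊆ F}

/-- `Bp` and `Bm` are dual: `↓ Bp ∩ ↑ Bm = ∅`, and `↓ Bp ∪ ↑ Bm` is the family of all closed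
sets. -/
def AreDual (T : ImplBase α) (Bp Bm : Set (Finset α)) : Prop :=
  T.ideal Bp ∩ T.upFilter Bm = ∅ ∧ T.ideal Bp ∪ T.upFilter Bm = T.closedSets

/-- The base on the ground set `α ∪ {z}`, where the fresh element `z` is `none : Option α`, which
consists of the implications of `T` and of an implication `A → z` for every `A ∈ Bm`. -/
def addSink (T : ImplBase α) (Bm : Set (Finset α)) : ImplBase (Option α) :=
  {q | ∃ p ∈ T, q = (p.1.map Function.Embedding.some, some p.2)} ∪
    {q | ∃ A ∈ Bm, q = (A.map Function.Embedding.some, none)}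

end

end ImplBase

/-! ## Polynomial time

The machine model is the WHILE language over binary trees (list structures) of the textbooks, with
unit cost for each of `nil`, `cons`, `hd`, `tl`, a variable access, an assignment and a test for
`nil`. A step builds at most one new cell over existing ones, and the only test is whether a value
is `nil`, so a run of `t` steps on an input of size `m` is carried out, with shared cells, by a
Turing machine in time polynomial in `t + m`; conversely, a stack or tape operation takes a bounded
number of steps. Hence polynomial time in this model is polynomial time in the usual sense. -/

namespace WhileLang

/-- Data values: binary trees. -/
inductive Val : Type
  | nil : Val
  | cons : Val → Val → Val

namespace Val

/-- The size of a value: its number of nodes, leaves included. -/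
def size : Val → ℕ
  | nil => 1
  | cons a b => a.size + b.size + 1

/-- First component (`nil` for `nil`). -/
def hd : Val → Val
  | nil => nil
  | cons a _ => a

/-- Second component (`nil` for `nil`). -/
def tl : Val → Val
  | nil => nil
  | cons _ b => b

/-- A list of values, as a value. -/
def ofList : List Val → Val
  | [] => nil
  | a :: l => cons a (ofList l)

/-- A truth value, as a value. -/
def ofBool : Bool → Val
  | false => nil
  | true => cons nil nil

/-- A natural number in unary, as a value. -/
def ofNat (n : ℕ) : Val :=
  ofList (List.replicate n nil)

/-- A subset of `{0, …, n - 1}`, as the value of its characteristic vector. -/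
def ofSet {n : ℕ} (S : Finset (Fin n)) : Val :=
  ofList (List.ofFn fun i => ofBool (decide (i ∈ S)))

/-- A list of subsets of `{0, …, n - 1}`, as a value. -/
def ofFamily {n : ℕ} (l : List (Finset (Fin n))) : Val :=
  ofList (l.map ofSet)

/-- A list of implications on the ground set `{0, …, n - 1}`, as a value. -/
def ofBase {n : ℕ} (l : List (Finset (Fin n) × Fin n)) : Val :=
  ofList (l.map fun p => cons (ofSet p.1) (ofNat p.2))

end Val

/-- A store assigns a value to each of the variables `0, 1, 2, …`. -/
abbrev Store : Type := ℕ → Val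

/-- Expressions. -/
inductive Expr : Type
  | var : ℕ → Expr
  | nil : Expr
  | cons : Expr → Expr → Expr
  | hd : Expr → Expr
  | tl : Expr → Expr

namespace Expr

/-- The value of an expression in a store. -/
def eval (s : Store) : Expr → Val
  | var x => s x
  | nil => Val.nil
  | cons e f => Val.cons (e.eval s) (f.eval s)
  | hd e => (e.eval s).hd
  | tl e => (e.eval s).tl

/-- The number of steps needed to evaluate an expression. -/
def cost : Expr → ℕ
  | var _ => 1
  | nil => 1
  | cons e f => e.cost + f.cost + 1
  | hd e => e.cost + 1
  | tl e => e.cost + 1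

end Expr

/-- Programs. -/
inductive Cmd : Type
  | skip : Cmd
  | assign : ℕ → Expr → Cmd
  | seq : Cmd → Cmd → Cmd
  | ite : Expr → Cmd → Cmd → Cmd
  | loop : Expr → Cmd → Cmd

/-- `Exec c s t s'`: the program `c`, started in the store `s`, halts after `t` steps in the store
`s'`. A test succeeds when the value of the tested expression is not `nil`. -/
inductive Exec : Cmd → Store → ℕ → Store → Prop
  | skip (s : Store) : Exec Cmd.skip s 1 s
  | assign (s : Store) (x : ℕ) (e : Expr) :
      Exec (Cmd.assign x e) s (e.cost + 1) (Function.update s x (e.eval s))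
  | seq {c d : Cmd} {s s' s'' : Store} {t t' : ℕ} :
      Exec c s t s' → Exec d s' t' s'' → Exec (Cmd.seq c d) s (t + t') s''
  | ite_true {e : Expr} {c d : Cmd} {s s' : Store} {t : ℕ} :
      e.eval s ≠ Val.nil → Exec c s t s' → Exec (Cmd.ite e c d) s (e.cost + 1 + t) s'
  | ite_false {e : Expr} {c d : Cmd} {s s' : Store} {t : ℕ} :
      e.eval s = Val.nil → Exec d s t s' → Exec (Cmd.ite e c d) s (e.cost + 1 + t) s'
  | loop_true {e : Expr} {c : Cmd} {s s' s'' : Store} {t t' : ℕ} :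
      e.eval s ≠ Val.nil → Exec c s t s' → Exec (Cmd.loop e c) s' t' s'' →
      Exec (Cmd.loop e c) s (e.cost + 1 + t + t') s''
  | loop_false {e : Expr} {c : Cmd} {s : Store} :
      e.eval s = Val.nil → Exec (Cmd.loop e c) s (e.cost + 1) s

/-- The initial store on input `v`: variable `0` holds `v`, every other variable holds `nil`. -/
def initStore (v : Val) : Store :=
  Function.update (fun _ => Val.nil) 0 v

/-- A decision problem restricted to a class of inputs: the instances, their encoding, the class of
instances under consideration, and the positive instances. -/
structure Problem where
  /-- The instances. -/
  Inst : Type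
  /-- The encoding of an instance. -/
  enc : Inst → Val
  /-- The instance belongs to the class under consideration. -/
  Admissible : Inst → Prop
  /-- The instance is a positive one. -/
  Positive : Inst → Prop

/-- There is a polynomial-time algorithm that solves the problem: some program halts on every
admissible instance, within a number of steps that is polynomial in the size of the encoding of the
instance, and its answer (variable `0` is not `nil`) is correct. -/
def Problem.PolyTimeSolvable (P : Problem) : Prop :=
  ∃ (c : Cmd) (p : Polynomial ℕ), ∀ I : P.Inst, P.Admissible I →
    ∃ (t : ℕ) (s : Store), Exec c (initStore (P.enc I)) t s ∧
      t ≤ p.eval (P.enc I).size ∧ (s 0 ≠ Val.nil ↔ P.Positive I)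

end WhileLang

/-! ## The two decision problems -/

/-- An input of the identification problem of meet-irreducible elements: an implicational base on
the ground set `{0, …, n - 1}`, and a family of subsets of that ground set, both given by lists. -/
structure CMIInput where
  /-- The size of the ground set. -/
  n : ℕ
  /-- The implications. -/
  base : List (Finset (Fin n) × Fin n)
  /-- The sets of the family. -/
  family : List (Finset (Fin n))

namespace CMIInput

/-- The implicational base of an input. -/
def implBase (I : CMIInput) : ImplBase (Fin I.n) := {p | p ∈ I.base}

/-- The family of sets of an input. -/
def sets (I : CMIInput) : Set (Finset (Fin I.n)) := {M | M ∈ I.family}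

/-- The encoding of an input. -/
def enc (I : CMIInput) : WhileLang.Val :=
  WhileLang.Val.ofList
    [WhileLang.Val.ofNat I.n, WhileLang.Val.ofBase I.base, WhileLang.Val.ofFamily I.family]

end CMIInput

/-- An input of the dualization problem: an implicational base on the ground set `{0, …, n - 1}`,
and two families of subsets of that ground set, all given by lists. -/
structure DualInput where
  /-- The size of the ground set. -/
  n : ℕ
  /-- The implications. -/
  base : List (Finset (Fin n) × Fin n)
  /-- The sets of the first family. -/
  pos : List (Finset (Fin n))
  /-- The sets of the second family. -/
  neg : List (Finset (Fin n))

namespace DualInput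

/-- The implicational base of an input. -/
def implBase (I : DualInput) : ImplBase (Fin I.n) := {p | p ∈ I.base}

/-- The first family of an input. -/
def posSets (I : DualInput) : Set (Finset (Fin I.n)) := {B | B ∈ I.pos}

/-- The second family of an input. -/
def negSets (I : DualInput) : Set (Finset (Fin I.n)) := {B | B ∈ I.neg}

/-- The encoding of an input. -/
def enc (I : DualInput) : WhileLang.Val :=
  WhileLang.Val.ofList
    [WhileLang.Val.ofNat I.n, WhileLang.Val.ofBase I.base, WhileLang.Val.ofFamily I.pos,
      WhileLang.Val.ofFamily I.neg]

end DualInput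

/-- Identification of meet-irreducible elements in acyclic convex geometries: given an implicational
base whose closure space is an acyclic convex geometry, and any family of subsets of the ground set,
is the family the set of meet-irreducible elements of the closure system of the base? -/
def CMIAcyclic : WhileLang.Problem where
  Inst := CMIInput
  enc := CMIInput.enc
  Admissible I := I.implBase.IsAcyclicConvexGeometry
  Positive I := I.sets = I.implBase.meetIrreducibles

/-- Dualization in distributive lattices: given an implicational base whose closure space is
standard and whose lattice of closed sets is distributive, and two antichains of that lattice, are
these antichains dual? -/
def DualDistributive : WhileLang.Problem where
  Inst := DualInput
  enc := DualInput.enc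
  Admissible I := I.implBase.IsStandard ∧ I.implBase.IsDistributive ∧
    I.implBase.IsAntichainOf I.posSets ∧ I.implBase.IsAntichainOf I.negSets
  Positive I := I.implBase.AreDual I.posSets I.negSets

/-! The closed sets of the base with a sink `z` are the sets `C ∪ {z}` with `C` closed, together
with the closed `C` outside the filter of `Bm`. An intersection contains `z` only if both factors
do, so the meet-irreducibles with `z` are exactly the `M ∪ {z}`. A set `S` without `z` is the
intersection of `S ∪ {z}` with any larger closed set avoiding `z`; hence it is meet-irreducible iff
it is maximal among closed sets outside the filter. Duality says that these maximal sets form `Bp`.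
Acyclicity survives because no arc leaves `z`.

For the reduction, standardness and distributivity make every closure the union of the closures of
singletons (`exists_mem_closure_singleton`). The given base may be cyclic, but the same closed sets
come from an acyclic base with singleton premises (`closedSets_unary`, `isAcyclic_unary`), and
adding the sink to that base shows that the new instance is admissible. The meet-irreducibles of the
original lattice are the sets `{y | x ∉ φ(y)}` for `x ∈ X` (`meetIrreducibles_eq_range_avoid`), at
most `n` of them, each computable by forward chaining; so the candidate family can be written down
in polynomial time. If `∅ ∈ Bm`, the new space is not standard; then duality just means `Bp = ∅`,
and a fixed instance with empty ground set is produced instead.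

The running time is handled by a class of feasible functions, closed under composition, branching
and iterations clocked by a component of the input. As every step has unit cost, nested clocked
loops take polynomial time whatever the size of the intermediate values; the size of the output is
bounded separately (`CMIInput.size_enc_le`). -/

namespace WhileLang

/-! ### Length and size of values -/

namespace Val

/-- The number of cells on the right spine of a value: the length of the list that it encodes. -/
def len : Val → ℕ
  | nil => 0
  | cons _ b => b.len + 1

/-- The component number `c` of a value that encodes a list. -/
def part (c : ℕ) (v : Val) : Val := (tl^[c] v).hd

/-- Case distinction on whether a value is `nil`. -/
def ite : Val → Val → Val → Val
  | nil, _, b => b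
  | cons _ _, a, _ => a

theorem len_le_size (v : Val) : v.len ≤ v.size := by
  induction v with
  | nil => simp [len]
  | cons a b _ ih => simp only [len, size]; omega

theorem size_hd_le (v : Val) : v.hd.size ≤ v.size := by
  cases v <;> simp only [hd, size] <;> omega

theorem size_tl_le (v : Val) : v.tl.size ≤ v.size := by
  cases v <;> simp only [tl, size] <;> omega

theorem size_part_le (c : ℕ) (v : Val) : (part c v).size ≤ v.size := by
  unfold part
  refine (size_hd_le _).trans ?_
  induction c with
  | zero => exact le_rfl
  | succ c ih => rw [Function.iterate_succ_apply']; exact (size_tl_le _).trans ih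

theorem len_part_le (c : ℕ) (v : Val) : (part c v).len ≤ v.size :=
  (len_le_size _).trans (size_part_le c v)

end Val

/-! ### Feasible functions and many-one reductions -/

open Val

/-- The expression for the component number `c` of variable `0`. -/
def partExpr (c : ℕ) : Expr := Expr.hd (Expr.tl^[c] (Expr.var 0))

theorem eval_partExpr (c : ℕ) (s : Store) : (partExpr c).eval s = part c (s 0) := by
  have h : ∀ c : ℕ, (Expr.tl^[c] (Expr.var 0)).eval s = tl^[c] (s 0) := by
    intro c
    induction c with
    | zero => rfl
    | succ c ih => rw [Function.iterate_succ_apply', Function.iterate_succ_apply', Expr.eval, ih]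
  rw [partExpr, Expr.eval, h, part]

theorem eval_mono (p : Polynomial ℕ) {a b : ℕ} (h : a ≤ b) : p.eval a ≤ p.eval b := by
  rw [Polynomial.eval_eq_sum_range, Polynomial.eval_eq_sum_range]
  gcongr

/-- A function of a fixed input and of an environment is feasible when, for every `k ≥ 1`, some
program computes it from the input in variable `0` and the environment in variable `k`, leaving the
result in variable `k`, without changing the variables below `k` and from some `K` on, in time
polynomial in the size of the input alone. -/
def Feasible (f : Val → Val → Val) : Prop :=
  ∀ k : ℕ, 1 ≤ k → ∃ (c : Cmd) (K : ℕ) (T : Polynomial ℕ), ∀ s : Store, ∃ (t : ℕ) (s' : Store),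
    Exec c s t s' ∧ t ≤ T.eval (s 0).size ∧ s' k = f (s 0) (s k) ∧
      (∀ j < k, s' j = s j) ∧ ∀ j ≥ K, s' j = s j

namespace Feasible

theorem of_expr (f : Val → Val → Val) (e : ℕ → Expr)
    (h : ∀ k s, (e k).eval s = f (s 0) (s k)) : Feasible f := by
  intro k _
  refine ⟨Cmd.assign k (e k), k + 1, Polynomial.C ((e k).cost + 1), fun s =>
    ⟨_, _, Exec.assign s k (e k), by simp, by simp [h], ?_, ?_⟩⟩
  · intro j hj
    exact Function.update_of_ne (by omega) _ _
  · intro j hj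
    exact Function.update_of_ne (by omega) _ _

theorem env : Feasible fun _ e => e :=
  of_expr _ Expr.var fun _ _ => rfl

theorem nil : Feasible fun _ _ => Val.nil :=
  of_expr _ (fun _ => Expr.nil) fun _ _ => rfl

theorem comp {f g : Val → Val → Val} (hg : Feasible g) (hf : Feasible f) :
    Feasible fun i e => g i (f i e) := by
  intro k hk
  obtain ⟨c, K, T, h⟩ := hf k hk
  obtain ⟨c', K', T', h'⟩ := hg k hk
  refine ⟨Cmd.seq c c', max K K', T + T', fun s => ?_⟩
  obtain ⟨t, s₁, e₁, ht, hv, hlo, hhi⟩ := h s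
  obtain ⟨t', s₂, e₂, ht', hv', hlo', hhi'⟩ := h' s₁
  have h0 : s₁ 0 = s 0 := hlo 0 (by omega)
  refine ⟨_, s₂, Exec.seq e₁ e₂, ?_, ?_, ?_, ?_⟩
  · rw [h0] at ht'
    rw [Polynomial.eval_add]
    omega
  · rw [hv', hv, h0]
  · intro j hj
    rw [hlo' j hj, hlo j hj]
  · intro j hj
    rw [hhi' j (by omega), hhi j (by omega)]

theorem hd {f : Val → Val → Val} (hf : Feasible f) : Feasible fun i e => (f i e).hd :=
  comp (g := fun _ e => e.hd) (of_expr _ (fun k => Expr.hd (Expr.var k)) fun _ _ => rfl) hf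

theorem tl {f : Val → Val → Val} (hf : Feasible f) : Feasible fun i e => (f i e).tl :=
  comp (g := fun _ e => e.tl) (of_expr _ (fun k => Expr.tl (Expr.var k)) fun _ _ => rfl) hf

theorem part (c : ℕ) : Feasible fun i _ => Val.part c i :=
  of_expr _ (fun _ => partExpr c) fun _ s => eval_partExpr c s

theorem cons {f g : Val → Val → Val} (hf : Feasible f) (hg : Feasible g) :
    Feasible fun i e => Val.cons (f i e) (g i e) := by
  intro k hk
  obtain ⟨c, K, T, h⟩ := hf (k + 1) (by omega)
  obtain ⟨c', K', T', h'⟩ := hg (k + 2) (by omega)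
  -- Both programs work on copies of the environment: the first preserves variable `k`, the second
  -- also preserves the first result in `k + 1`.
  refine ⟨Cmd.seq (Cmd.assign (k + 1) (Expr.var k)) (Cmd.seq c
    (Cmd.seq (Cmd.assign (k + 2) (Expr.var k)) (Cmd.seq c'
      (Cmd.assign k (Expr.cons (Expr.var (k + 1)) (Expr.var (k + 2))))))),
    max (k + 3) (max K K'), T + T' + Polynomial.C 8, fun s => ?_⟩
  obtain ⟨t, s₁, e₁, ht, hv, hlo, hhi⟩ := h (Function.update s (k + 1) (s k))
  obtain ⟨t', s₂, e₂, ht', hv', hlo', hhi'⟩ := h' (Function.update s₁ (k + 2) (s₁ k))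
  have ne : ∀ {a b : ℕ} (w : Store) (v : Val), a ≠ b → Function.update w b v a = w a :=
    fun w v hab => Function.update_of_ne hab v w
  rw [ne _ _ (by omega)] at ht hv
  rw [Function.update_self] at hv hv'
  have h0 : s₁ 0 = s 0 := by rw [hlo 0 (by omega), ne _ _ (by omega)]
  have h1 : s₁ k = s k := by rw [hlo k (by omega), ne _ _ (by omega)]
  rw [ne _ _ (by omega), h0] at ht' hv'
  refine ⟨_, _, Exec.seq (Exec.assign _ _ _) (Exec.seq e₁ (Exec.seq (Exec.assign _ _ _)
    (Exec.seq e₂ (Exec.assign _ _ _)))), ?_, ?_, ?_, ?_⟩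
  · simp only [Polynomial.eval_add, Polynomial.eval_C, Expr.cost]
    omega
  · rw [Function.update_self, Expr.eval, Expr.eval, Expr.eval, hv', hlo' _ (by omega),
      ne _ _ (by omega), hv, h1]
  · intro j hj
    rw [ne _ _ (by omega), hlo' j (by omega), ne _ _ (by omega), hlo j (by omega),
      ne _ _ (by omega)]
  · intro j hj
    rw [ne _ _ (by omega), hhi' j (by omega), ne _ _ (by omega), hhi j (by omega),
      ne _ _ (by omega)]

theorem ite {f g h : Val → Val → Val} (hf : Feasible f) (hg : Feasible g) (hh : Feasible h) :
    Feasible fun i e => (f i e).ite (g i e) (h i e) := by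
  intro k hk
  obtain ⟨c, K, T, H⟩ := hf (k + 1) (by omega)
  obtain ⟨c₁, K₁, T₁, H₁⟩ := hg k hk
  obtain ⟨c₂, K₂, T₂, H₂⟩ := hh k hk
  refine ⟨Cmd.seq (Cmd.assign (k + 1) (Expr.var k)) (Cmd.seq c
    (Cmd.ite (Expr.var (k + 1)) c₁ c₂)),
    max (k + 2) (max K (max K₁ K₂)), T + T₁ + T₂ + Polynomial.C 4, fun s => ?_⟩
  obtain ⟨t, s₁, e₁, ht, hv, hlo, hhi⟩ := H (Function.update s (k + 1) (s k))
  have ne : ∀ {a b : ℕ} (w : Store) (v : Val), a ≠ b → Function.update w b v a = w a :=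
    fun w v hab => Function.update_of_ne hab v w
  rw [ne _ _ (by omega)] at ht hv
  rw [Function.update_self] at hv
  have h0 : s₁ 0 = s 0 := by rw [hlo 0 (by omega), ne _ _ (by omega)]
  have h1 : s₁ k = s k := by rw [hlo k (by omega), ne _ _ (by omega)]
  obtain ⟨t₁, r₁, E₁, ht₁, hv₁, hlo₁, hhi₁⟩ := H₁ s₁
  obtain ⟨t₂, r₂, E₂, ht₂, hv₂, hlo₂, hhi₂⟩ := H₂ s₁
  rw [h0] at ht₁ hv₁ ht₂ hv₂
  rw [h1] at hv₁ hv₂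
  cases hfe : f (s 0) (s k) with
  | nil =>
    refine ⟨_, r₂, Exec.seq (Exec.assign _ _ _) (Exec.seq e₁ (Exec.ite_false ?_ E₂)),
      ?_, ?_, ?_, ?_⟩
    · rw [Expr.eval, hv, hfe]
    · simp only [Polynomial.eval_add, Polynomial.eval_C, Expr.cost]
      omega
    · simp only [hv₂, hfe, Val.ite]
    · intro j hj
      rw [hlo₂ j (by omega), hlo j (by omega), ne _ _ (by omega)]
    · intro j hj
      rw [hhi₂ j (by omega), hhi j (by omega), ne _ _ (by omega)]
  | cons a b =>
    refine ⟨_, r₁, Exec.seq (Exec.assign _ _ _) (Exec.seq e₁ (Exec.ite_true ?_ E₁)),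
      ?_, ?_, ?_, ?_⟩
    · rw [Expr.eval, hv, hfe]
      exact Val.noConfusion
    · simp only [Polynomial.eval_add, Polynomial.eval_C, Expr.cost]
      omega
    · simp only [hv₁, hfe, Val.ite]
    · intro j hj
      rw [hlo₁ j (by omega), hlo j (by omega), ne _ _ (by omega)]
    · intro j hj
      rw [hhi₁ j (by omega), hhi j (by omega), ne _ _ (by omega)]

/-- Iteration, clocked by a component of the input. -/
theorem iterate (c : ℕ) {f g : Val → Val → Val} (hg : Feasible g) (hf : Feasible f) :
    Feasible fun i e => (g i)^[(Val.part c i).len] (f i e) := by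
  refine comp (g := fun i e => (g i)^[(Val.part c i).len] e) ?_ hf
  intro k hk
  -- The state lives in variable `k + 1`, so that the body cannot touch the loop counter in variable
  -- `k`.
  obtain ⟨b, K, T, H⟩ := hg (k + 1) (by omega)
  have ne : ∀ {a b : ℕ} (w : Store) (v : Val), a ≠ b → Function.update w b v a = w a :=
    fun w v hab => Function.update_of_ne hab v w
  -- Each round costs 2 for the test, 3 for shortening the counter and at most `T` for the body; the
  -- last, failing test costs 2.
  have main : ∀ (v : Val) (s : Store), s k = v → ∃ (t : ℕ) (s' : Store),
      Exec (Cmd.loop (Expr.var k) (Cmd.seq (Cmd.assign k (Expr.tl (Expr.var k))) b)) s t s' ∧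
      t ≤ v.len * (T.eval (s 0).size + 5) + 2 ∧ s' (k + 1) = (g (s 0))^[v.len] (s (k + 1)) ∧
      (∀ j < k, s' j = s j) ∧ ∀ j ≥ max (k + 2) K, s' j = s j := by
    intro v
    induction v with
    | nil =>
      intro s hs
      exact ⟨_, s, Exec.loop_false (by rw [Expr.eval, hs]), by simp [Val.len, Expr.cost], rfl,
        fun _ _ => rfl, fun _ _ => rfl⟩
    | cons x v _ ih =>
      intro s hs
      obtain ⟨t, s₁, e₁, ht, hv, hlo, hhi⟩ := H (Function.update s k v)
      rw [ne _ _ (by omega)] at ht hv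
      rw [ne _ _ (by omega)] at hv
      have h0 : s₁ 0 = s 0 := by rw [hlo 0 (by omega), ne _ _ (by omega)]
      obtain ⟨t', s₂, e₂, ht', hv', hlo', hhi'⟩ :=
        ih s₁ (by rw [hlo k (by omega), Function.update_self])
      rw [h0] at ht' hv'
      have e₀ : Exec (Cmd.assign k (Expr.tl (Expr.var k))) s 3 (Function.update s k v) := by
        have := Exec.assign s k (Expr.tl (Expr.var k))
        simpa [Expr.eval, hs, Val.tl, Expr.cost] using this
      refine ⟨_, s₂, Exec.loop_true ?_ (Exec.seq e₀ e₁) e₂, ?_, ?_, ?_, ?_⟩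
      · rw [Expr.eval, hs]
        exact Val.noConfusion
      · simp only [Val.len, Expr.cost, Nat.add_mul]
        omega
      · rw [hv', hv, Val.len, Function.iterate_succ_apply]
      · intro j hj
        rw [hlo' j hj, hlo j (by omega), ne _ _ (by omega)]
      · intro j hj
        rw [hhi' j (by omega), hhi j (by omega), ne _ _ (by omega)]
  refine ⟨Cmd.seq (Cmd.assign (k + 1) (Expr.var k)) (Cmd.seq (Cmd.assign k (partExpr c))
    (Cmd.seq (Cmd.loop (Expr.var k) (Cmd.seq (Cmd.assign k (Expr.tl (Expr.var k))) b))
      (Cmd.assign k (Expr.var (k + 1))))), max (k + 2) K,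
    Polynomial.X * (T + Polynomial.C 5) + Polynomial.C ((partExpr c).cost + 7), fun s => ?_⟩
  have hp : (partExpr c).eval (Function.update s (k + 1) (s k)) = Val.part c (s 0) := by
    rw [eval_partExpr, ne _ _ (by omega)]
  obtain ⟨t, s₁, e₁, ht, hv, hlo, hhi⟩ := main (Val.part c (s 0))
    (Function.update (Function.update s (k + 1) (s k)) k (Val.part c (s 0)))
    (Function.update_self _ _ _)
  rw [ne _ _ (by omega), ne _ _ (by omega)] at ht hv
  rw [ne _ _ (by omega), Function.update_self] at hv
  refine ⟨_, _, Exec.seq (Exec.assign _ _ _) (Exec.seq (Exec.assign _ _ _)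
    (Exec.seq (hp ▸ e₁) (Exec.assign _ _ _))), ?_, ?_, ?_, ?_⟩
  · have := Nat.mul_le_mul_right (T.eval (s 0).size + 5) (len_part_le c (s 0))
    simp only [Polynomial.eval_add, Polynomial.eval_mul, Polynomial.eval_X, Polynomial.eval_C,
      Expr.cost]
    omega
  · rw [Function.update_self, Expr.eval, hv]
  · intro j hj
    rw [ne _ _ (by omega), hlo j hj, ne _ _ (by omega), ne _ _ (by omega)]
  · intro j hj
    rw [ne _ _ (by omega), hhi j hj, ne _ _ (by omega), ne _ _ (by omega)]

end Feasible

/-- The program that sets the variables `1, …, m` to `nil`. -/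
def clear : ℕ → Cmd
  | 0 => Cmd.skip
  | m + 1 => Cmd.seq (clear m) (Cmd.assign (m + 1) Expr.nil)

theorem exec_clear (m : ℕ) (s : Store) :
    Exec (clear m) s (2 * m + 1) fun j => if 1 ≤ j ∧ j ≤ m then Val.nil else s j := by
  induction m with
  | zero =>
    convert Exec.skip s using 1
    · rfl
    funext j
    exact if_neg (by omega)
  | succ m ih =>
    convert Exec.seq ih (Exec.assign _ (m + 1) Expr.nil) using 1
    · rfl
    · rfl
    funext j
    by_cases hj : j = m + 1
    · subst hj
      simp [Expr.eval]
    · rw [Function.update_of_ne hj]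
      exact if_congr (by omega) rfl rfl

/-- Polynomial-time solvability is inherited along feasible many-one reductions. -/
theorem Problem.PolyTimeSolvable.of_reduction {P Q : Problem} (f : Val → Val)
    (hf : Feasible fun i _ => f i) (q : Polynomial ℕ)
    (hred : ∀ I : Q.Inst, Q.Admissible I → ∃ J : P.Inst, P.Admissible J ∧ P.enc J = f (Q.enc I) ∧
      (P.enc J).size ≤ q.eval (Q.enc I).size ∧ (P.Positive J ↔ Q.Positive I))
    (hP : P.PolyTimeSolvable) : Q.PolyTimeSolvable := by
  obtain ⟨c, p, hc⟩ := hP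
  obtain ⟨r, K, T, hr⟩ := hf 1 le_rfl
  refine ⟨Cmd.seq r (Cmd.seq (Cmd.assign 0 (Expr.var 1)) (Cmd.seq (clear (K + 1)) c)),
    T + Polynomial.C (2 * K + 5) + p.comp q, fun I hI => ?_⟩
  obtain ⟨J, hJ, henc, hsize, hpos⟩ := hred I hI
  obtain ⟨t, s, e, ht, hs⟩ := hc J hJ
  obtain ⟨t', s', e', ht', hv, -, hhi⟩ := hr (initStore (Q.enc I))
  -- The reduction leaves debris only in variables below `K`; after clearing, the store is exactly
  -- the initial store on the new instance, as the given solver requires.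
  have h0 : initStore (Q.enc I) 0 = Q.enc I := Function.update_self _ _ _
  have hst : (fun j => if 1 ≤ j ∧ j ≤ K + 1 then Val.nil else
      Function.update s' 0 ((Expr.var 1).eval s') j) = initStore (P.enc J) := by
    funext j
    rcases Nat.eq_zero_or_pos j with rfl | hj
    · rw [if_neg (by omega), Function.update_self, initStore, Function.update_self, henc,
        Expr.eval, hv, h0]
    · have : initStore (P.enc J) j = Val.nil := Function.update_of_ne (by omega) _ _
      rw [this]
      split_ifs with h
      · rfl
      · rw [Function.update_of_ne (by omega), hhi j (by omega)]
        exact Function.update_of_ne (by omega) _ _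
  have e₂ := exec_clear (K + 1) (Function.update s' 0 ((Expr.var 1).eval s'))
  rw [hst] at e₂
  refine ⟨_, s, Exec.seq e' (Exec.seq (Exec.assign _ _ _) (Exec.seq e₂ e)), ?_, hs.trans hpos⟩
  have := eval_mono p hsize
  rw [h0] at ht'
  simp only [Polynomial.eval_add, Polynomial.eval_C, Polynomial.eval_comp, Expr.cost]
  omega

end WhileLang

/-! ### Subroutines on unary numbers, lists and characteristic vectors -/

namespace WhileLang

open Val

namespace Val

/-- Left fold over the list encoded by a value, stopped after `N` elements. -/
def foldN : ℕ → (Val → Val → Val) → Val → Val → Val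
  | 0, _, _, a => a
  | _ + 1, _, nil, a => a
  | N + 1, f, cons x l, a => foldN N f l (f x a)

/-- The truth value `true`. -/
abbrev tt : Val := cons nil nil

/-- The list encoded by `l` without its first `|x|` elements, where `|x| ≤ |n|`. -/
def dropV (n x l : Val) : Val := foldN n.len (fun _ l => l.tl) x l

/-- The entry with the unary index `x` of the list encoded by `l`. -/
def lookup (n x l : Val) : Val := (dropV n x l).hd

/-- Equality of unary numbers. -/
def eqv (n x y : Val) : Val := (dropV n x y).ite nil ((dropV n y x).ite nil tt)

/-- The list of the values of `f` at the unary numbers less than `n`. -/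
def tabulate (n : Val) (f : Val → Val) : Val :=
  (foldN n.len (fun _ st => cons st.hd.tl (cons (f st.hd.tl) st.tl)) n (cons n nil)).tl

/-- Some entry of the list encoded by `l` is not `nil`. -/
def anyV (n l : Val) : Val := foldN n.len (fun x a => x.ite tt a) l nil

/-- Insertion of an element into a characteristic vector. -/
def insertV (n b S : Val) : Val := tabulate n fun y => (eqv n y b).ite tt (lookup n y S)

/-- The characteristic vector `A` is not contained in `S`. -/
def notSubset (n A S : Val) : Val :=
  anyV n (tabulate n fun y => (lookup n y A).ite ((lookup n y S).ite nil tt) nil)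

theorem len_ofList (l : List Val) : (ofList l).len = l.length := by
  induction l with
  | nil => rfl
  | cons a l ih => simp [ofList, len, ih]

@[simp] theorem len_ofNat (n : ℕ) : (ofNat n).len = n := by
  simp [ofNat, len_ofList]

theorem ofNat_succ (n : ℕ) : ofNat (n + 1) = cons nil (ofNat n) := by
  simp [ofNat, List.replicate_succ, ofList]

theorem foldN_ofList (N : ℕ) (f : Val → Val → Val) (l : List Val) (a : Val) (h : l.length ≤ N) :
    foldN N f (ofList l) a = l.foldl (fun a x => f x a) a := by
  induction l generalizing N a with
  | nil => cases N <;> rfl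
  | cons x l ih =>
    cases N with
    | zero => simp at h
    | succ N => simpa [ofList, foldN] using ih N (f x a) (by simpa using h)

theorem foldN_ofNat (N : ℕ) (f : Val → Val) (k : ℕ) (a : Val) (h : k ≤ N) :
    foldN N (fun _ => f) (ofNat k) a = f^[k] a := by
  induction k generalizing N a with
  | zero => cases N <;> rfl
  | succ k ih =>
    cases N with
    | zero => omega
    | succ N =>
      rw [ofNat_succ, foldN, ih N _ (by omega), Function.iterate_succ_apply]

theorem dropV_ofList {n k : ℕ} (h : k ≤ n) (l : List Val) :
    dropV (ofNat n) (ofNat k) (ofList l) = ofList (l.drop k) := by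
  rw [dropV, len_ofNat, foldN_ofNat _ _ _ _ h]
  induction k generalizing l with
  | zero => rfl
  | succ k ih =>
    rw [Function.iterate_succ_apply]
    cases l with
    | nil => exact (ih (by omega) []).trans (by rw [List.drop_nil, List.drop_nil])
    | cons x l => exact ih (by omega) l

theorem lookup_ofFn {n : ℕ} (y : Fin n) (g : Fin n → Val) :
    lookup (ofNat n) (ofNat y) (ofList (List.ofFn g)) = g y := by
  rw [lookup, dropV_ofList y.is_lt.le, List.drop_eq_getElem_cons (by simp)]
  simp [ofList, hd]

theorem lookup_ofSet {n : ℕ} (y : Fin n) (S : Finset (Fin n)) :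
    lookup (ofNat n) (ofNat y) (ofSet S) = ofBool (decide (y ∈ S)) :=
  lookup_ofFn y _

theorem ite_ofBool (p : Prop) [Decidable p] (a b : Val) :
    (ofBool (decide p)).ite a b = if p then a else b := by
  by_cases h : p <;> simp [h, ofBool, ite]

/-- Dropping `x` cells from unary `y` is truncated subtraction; the numbers agree iff both
differences vanish. -/
theorem eqv_ofNat {n x y : ℕ} (hx : x ≤ n) (hy : y ≤ n) :
    eqv (ofNat n) (ofNat x) (ofNat y) = ofBool (decide (x = y)) := by
  have h : ∀ {x y : ℕ}, x ≤ n → dropV (ofNat n) (ofNat x) (ofNat y) = ofNat (y - x) := by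
    intro x y hx
    rw [show ofNat y = ofList (List.replicate y nil) from rfl, dropV_ofList hx,
      List.drop_replicate, ofNat]
  rw [eqv, h hx, h hy]
  rcases lt_trichotomy x y with hxy | rfl | hxy
  · obtain ⟨k, hk⟩ : ∃ k, y - x = k + 1 := ⟨y - x - 1, by omega⟩
    rw [hk, ofNat_succ, decide_eq_false hxy.ne]
    rfl
  · simp [ofNat, ofList, ite, ofBool]
  · obtain ⟨k, hk⟩ : ∃ k, x - y = k + 1 := ⟨x - y - 1, by omega⟩
    rw [hk, ofNat_succ, decide_eq_false hxy.ne', show y - x = 0 by omega]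
    rfl

theorem tabulate_ofNat (n : ℕ) (f : Val → Val) :
    tabulate (ofNat n) f = ofList (List.ofFn fun y : Fin n => f (ofNat y)) := by
  -- The state pairs a decreasing counter with the list built so far. The values are consed from
  -- index `k - 1` down to `0`, so the list comes out in order.
  have h : ∀ (k : ℕ) (l : List Val),
      (fun st : Val => cons st.hd.tl (cons (f st.hd.tl) st.tl))^[k] (cons (ofNat k) (ofList l)) =
        cons nil (ofList ((List.ofFn fun y : Fin k => f (ofNat y)) ++ l)) := by
    intro k
    induction k with
    | zero => intro l; rfl
    | succ k ih =>
      intro l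
      rw [Function.iterate_succ_apply, ofNat_succ]
      refine (ih (f (ofNat k) :: l)).trans ?_
      rw [List.ofFn_succ_last]
      simp
  rw [tabulate, len_ofNat, foldN_ofNat n (fun st => cons st.hd.tl (cons (f st.hd.tl) st.tl)) n _
    le_rfl]
  have := h n []
  rw [show ofList [] = nil from rfl] at this
  rw [this, List.append_nil]
  rfl

theorem anyV_ofFn {n : ℕ} (p : Fin n → Prop) [DecidablePred p] [Decidable (∃ y, p y)] :
    anyV (ofNat n) (ofList (List.ofFn fun y => ofBool (decide (p y)))) =
      ofBool (decide (∃ y, p y)) := by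
  have h : ∀ (l : List Bool) (b : Bool),
      (l.map ofBool).foldl (fun a x => x.ite tt a) (ofBool b) = ofBool (b || l.any id) := by
    intro l
    induction l with
    | nil => simp
    | cons x l ih =>
      intro b
      have : (ofBool x).ite tt (ofBool b) = ofBool (b || x) := by
        cases x <;> cases b <;> rfl
      rw [List.map_cons, List.foldl_cons, this, ih]
      simp [Bool.or_assoc]
  rw [anyV, foldN_ofList _ _ _ _ (by simp)]
  have := h (List.ofFn fun y => decide (p y)) false
  rw [List.map_ofFn] at this
  refine this.trans (congrArg ofBool ?_)
  rw [Bool.eq_iff_iff]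
  simp [List.mem_ofFn]

theorem anyV_ofSet {n : ℕ} (S : Finset (Fin n)) :
    anyV (ofNat n) (ofSet S) = ofBool (decide S.Nonempty) :=
  (anyV_ofFn (· ∈ S)).trans (congrArg ofBool (decide_eq_decide.2 Iff.rfl))

theorem insertV_ofSet {n : ℕ} (b : Fin n) (S : Finset (Fin n)) :
    insertV (ofNat n) (ofNat b) (ofSet S) = ofSet (insert b S) := by
  rw [insertV, tabulate_ofNat, ofSet.eq_def (insert b S)]
  congr 2
  funext y
  rw [eqv_ofNat y.is_lt.le b.is_lt.le, ite_ofBool, lookup_ofSet]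
  by_cases h : y = b
  · simp [h, ofBool]
  · simp [h, Fin.val_inj]

theorem notSubset_ofSet {n : ℕ} (A S : Finset (Fin n)) :
    notSubset (ofNat n) (ofSet A) (ofSet S) = ofBool (decide (¬ A ⊆ S)) := by
  have : ∀ y : Fin n, (lookup (ofNat n) (ofNat y) (ofSet A)).ite
      ((lookup (ofNat n) (ofNat y) (ofSet S)).ite nil tt) nil =
        ofBool (decide (y ∈ A ∧ y ∉ S)) := by
    intro y
    rw [lookup_ofSet, lookup_ofSet, ite_ofBool, ite_ofBool]
    by_cases h : y ∈ A <;> by_cases h' : y ∈ S <;> simp [h, h', ofBool]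
  rw [notSubset, tabulate_ofNat]
  simp only [this]
  rw [anyV_ofFn]
  congr 1
  simp [Finset.subset_iff]

/-- Both are lists of `n` copies of `nil`; `closureV` therefore uses the component holding `n` as
the empty set. -/
theorem ofSet_empty (n : ℕ) : ofSet (∅ : Finset (Fin n)) = ofNat n := by
  simp [ofSet, ofNat, ofBool, List.ofFn_const]

/-- Taking the sink to be element `0` turns the extension of the ground set into a single `cons` at
the head. -/
theorem ofSet_map_succ {n : ℕ} (S : Finset (Fin n)) :
    ofSet (S.map (Fin.succEmb n)) = cons nil (ofSet S) := by
  rw [ofSet, List.ofFn_succ, ofList, ofSet]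
  congr 1
  · simp [ofBool, Fin.succ_ne_zero]
  · simp

theorem ofSet_insert_zero_map_succ {n : ℕ} (S : Finset (Fin n)) :
    ofSet (insert 0 (S.map (Fin.succEmb n))) = cons tt (ofSet S) := by
  rw [ofSet, List.ofFn_succ, ofList, ofSet]
  congr 1
  · simp [ofBool]
  · simp [Fin.succ_ne_zero]

theorem size_ofList_le (l : List Val) (m : ℕ) (h : ∀ v ∈ l, v.size ≤ m) :
    (ofList l).size ≤ l.length * (m + 1) + 1 := by
  induction l with
  | nil => simp [ofList, size]
  | cons a l ih =>
    have h1 := h a (by simp)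
    have h2 := ih fun v hv => h v (by simp [hv])
    simp only [ofList, size, List.length_cons, Nat.add_mul]
    omega

theorem size_ofNat_le (n : ℕ) : (ofNat n).size ≤ 2 * n + 1 := by
  have := size_ofList_le (List.replicate n nil) 1
    (fun v hv => by rw [List.eq_of_mem_replicate hv]; rfl)
  rw [List.length_replicate] at this
  rw [ofNat]
  omega

theorem size_ofSet_le {n : ℕ} (S : Finset (Fin n)) : (ofSet S).size ≤ 4 * n + 1 := by
  have := size_ofList_le (List.ofFn fun i => ofBool (decide (i ∈ S))) 3 (by
    intro v hv
    obtain ⟨i, rfl⟩ := List.mem_ofFn.1 hv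
    cases decide (i ∈ S) <;> simp [ofBool, size])
  rw [List.length_ofFn] at this
  rw [ofSet]
  omega

end Val

/-- The solver's time is measured in the size of its own input, and feasibility alone does not bound
that size: iterating `cons x x` builds exponentially large trees with shared cells. -/
theorem _root_.CMIInput.size_enc_le (J : CMIInput) :
    J.enc.size ≤ (6 * J.n + 8) * (J.base.length + J.family.length + 1) := by
  have h1 := size_ofNat_le J.n
  have h2 : (ofBase J.base).size ≤ J.base.length * (6 * J.n + 3 + 1) + 1 := by
    have := size_ofList_le (J.base.map fun p => Val.cons (ofSet p.1) (ofNat p.2)) (6 * J.n + 3) (by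
      intro v hv
      obtain ⟨p, -, rfl⟩ := List.mem_map.1 hv
      have := size_ofSet_le p.1
      have := size_ofNat_le p.2
      have := p.2.is_lt
      simp only [size]
      omega)
    rwa [List.length_map] at this
  have h3 : (ofFamily J.family).size ≤ J.family.length * (4 * J.n + 1 + 1) + 1 := by
    have := size_ofList_le (J.family.map ofSet) (4 * J.n + 1) (by
      intro v hv
      obtain ⟨p, -, rfl⟩ := List.mem_map.1 hv
      exact size_ofSet_le p)
    rwa [List.length_map] at this
  simp only [CMIInput.enc, ofList, size]
  nlinarith

/-! ### Feasibility of the subroutines -/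

namespace Feasible

/-- A clocked iteration on states `((rest, accumulator), env)`. The body sees the environment
extended by the pair of the current element and the accumulator, which is the shape of `hF`. -/
theorem foldN (c : ℕ) {F : Val → Val → Val → Val → Val} {l a : Val → Val → Val}
    (hF : Feasible fun i e => F i e.tl e.hd.hd e.hd.tl) (hl : Feasible l) (ha : Feasible a) :
    Feasible fun i e => Val.foldN (Val.part c i).len (F i e) (l i e) (a i e) := by
  have key := hd (iterate c
    (ite (hd (hd env)) (cons (cons (tl (hd (hd env)))
      (comp hF (cons (cons (hd (hd (hd env))) (tl (hd env))) (tl env)))) (tl env)) env)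
    (cons (cons hl ha) env)) |>.tl
  convert key using 3 with i e
  have : ∀ (N : ℕ) (l a : Val), Val.foldN N (F i e) l a =
      ((fun st : Val => st.hd.hd.ite (Val.cons (Val.cons st.hd.hd.tl
        (F i st.tl st.hd.hd.hd st.hd.tl)) st.tl) st)^[N] (Val.cons (Val.cons l a) e)).hd.tl := by
    intro N
    induction N with
    | zero => intro l a; rfl
    | succ N ih =>
      intro l a
      cases l with
      | nil =>
        -- Once the list is exhausted the state is a fixed point, matching the early stop of the
        -- fold.
        rw [Function.iterate_fixed (by rfl)]
        rfl
      | cons x l => exact ih _ _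
  exact this _ _ _

theorem dropV {x l : Val → Val → Val} (hx : Feasible x) (hl : Feasible l) :
    Feasible fun i e => Val.dropV (Val.part 0 i) (x i e) (l i e) :=
  foldN 0 (F := fun _ _ _ l => l.tl) (tl (tl (hd env))) hx hl

theorem lookup {x l : Val → Val → Val} (hx : Feasible x) (hl : Feasible l) :
    Feasible fun i e => Val.lookup (Val.part 0 i) (x i e) (l i e) :=
  hd (dropV hx hl)

theorem tt : Feasible fun _ _ => Val.tt := cons nil nil

theorem eqv {x y : Val → Val → Val} (hx : Feasible x) (hy : Feasible y) :
    Feasible fun i e => Val.eqv (Val.part 0 i) (x i e) (y i e) :=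
  ite (dropV hx hy) nil (ite (dropV hy hx) nil tt)

theorem tabulate {F : Val → Val → Val → Val} (hF : Feasible fun i e => F i e.tl e.hd) :
    Feasible fun i e => Val.tabulate (Val.part 0 i) (F i e) :=
  tl (foldN 0 (F := fun i e _ st => Val.cons st.hd.tl (Val.cons (F i e st.hd.tl) st.tl))
    (cons (tl (hd (tl (hd env))))
      (cons (comp hF (cons (tl (hd (tl (hd env)))) (tl env))) (tl (tl (hd env)))))
    (part 0) (cons (part 0) nil))

theorem anyV {l : Val → Val → Val} (hl : Feasible l) :
    Feasible fun i e => Val.anyV (Val.part 0 i) (l i e) :=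
  foldN 0 (F := fun _ _ x a => x.ite Val.tt a) (ite (hd (hd env)) tt (tl (hd env))) hl nil

theorem insertV {b S : Val → Val → Val} (hb : Feasible b) (hS : Feasible S) :
    Feasible fun i e => Val.insertV (Val.part 0 i) (b i e) (S i e) :=
  tabulate (F := fun i e y => (Val.eqv (Val.part 0 i) y (b i e)).ite Val.tt
      (Val.lookup (Val.part 0 i) y (S i e)))
    (ite (eqv (hd env) (comp hb (tl env))) tt (lookup (hd env) (comp hS (tl env))))

theorem notSubset {A S : Val → Val → Val} (hA : Feasible A) (hS : Feasible S) :
    Feasible fun i e => Val.notSubset (Val.part 0 i) (A i e) (S i e) :=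
  anyV (tabulate (F := fun i e y => (Val.lookup (Val.part 0 i) y (A i e)).ite
      ((Val.lookup (Val.part 0 i) y (S i e)).ite Val.nil Val.tt) Val.nil)
    (ite (lookup (hd env) (comp hA (tl env)))
      (ite (lookup (hd env) (comp hS (tl env))) nil tt) nil))

end Feasible

end WhileLang

/-! ### Closure operators, sinks and distributive closure spaces -/

namespace ImplBase

section

variable {α : Type*}

section Closure

variable [Fintype α] (T : ImplBase α)

theorem mem_closure {S : Finset α} {x : α} :
    x ∈ T.closure S ↔ ∀ C ∈ T.closedSets, S ⊆ C → x ∈ C := by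
  classical
  simp [closure]

theorem subset_closure (S : Finset α) : S ⊆ T.closure S :=
  fun _ hx => T.mem_closure.2 fun _ _ hS => hS hx

theorem closure_subset {S C : Finset α} (hC : C ∈ T.closedSets) (h : S ⊆ C) : T.closure S ⊆ C :=
  fun _ hx => T.mem_closure.1 hx C hC h

theorem closure_mem_closedSets (S : Finset α) : T.closure S ∈ T.closedSets :=
  fun p hp h => T.mem_closure.2 fun _ hC hS => hC p hp (h.trans (T.closure_subset hC hS))

theorem closure_mono {S S' : Finset α} (h : S ⊆ S') : T.closure S ⊆ T.closure S' :=
  T.closure_subset (T.closure_mem_closedSets S') (h.trans (T.subset_closure S'))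

theorem self_mem_closure (x : α) : x ∈ T.closure {x} :=
  T.subset_closure _ (Finset.mem_singleton_self x)

theorem closure_singleton_subset {C : Finset α} (hC : C ∈ T.closedSets) {x : α} (hx : x ∈ C) :
    T.closure {x} ⊆ C :=
  T.closure_subset hC (Finset.singleton_subset_iff.2 hx)

end Closure

theorem inter_mem_closedSets [DecidableEq α] (T : ImplBase α) {C D : Finset α}
    (hC : C ∈ T.closedSets) (hD : D ∈ T.closedSets) : C ∩ D ∈ T.closedSets :=
  fun p hp h => Finset.mem_inter.2 ⟨hC p hp (h.trans Finset.inter_subset_left),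
    hD p hp (h.trans Finset.inter_subset_right)⟩

/-! ### The base with an added sink -/

section AddSink

variable (T : ImplBase α) (Bm : Set (Finset α))

theorem map_some_subset_insertNone {A S : Finset α} :
    A.map Function.Embedding.some ⊆ Finset.insertNone S ↔ A ⊆ S := by
  simp [Finset.subset_iff]

/-- The new implications conclude the sink, so they hold in any set containing it. -/
theorem insertNone_mem_closedSets_addSink {S : Finset α} :
    Finset.insertNone S ∈ (T.addSink Bm).closedSets ↔ S ∈ T.closedSets := by
  constructor
  · intro h p hp hS
    simpa using h (p.1.map Function.Embedding.some, some p.2) (Or.inl ⟨p, hp, rfl⟩)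
      (map_some_subset_insertNone.2 hS)
  · rintro h _ (⟨p, hp, rfl⟩ | ⟨A, -, rfl⟩) hS
    · simpa using h p hp (map_some_subset_insertNone.1 hS)
    · simp

theorem map_some_mem_closedSets_addSink {S : Finset α} :
    S.map Function.Embedding.some ∈ (T.addSink Bm).closedSets ↔
      S ∈ T.closedSets ∧ S ∉ T.upFilter Bm := by
  constructor
  · intro h
    have hS : S ∈ T.closedSets := by
      intro p hp hS
      simpa using h (p.1.map Function.Embedding.some, some p.2) (Or.inl ⟨p, hp, rfl⟩)
        (Finset.map_subset_map.2 hS)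
    refine ⟨hS, fun ⟨_, A, hA, hAS⟩ => ?_⟩
    simpa using h (A.map Function.Embedding.some, none) (Or.inr ⟨A, hA, rfl⟩)
      (Finset.map_subset_map.2 hAS)
  · rintro ⟨h, hS'⟩ _ (⟨p, hp, rfl⟩ | ⟨A, hA, rfl⟩) hS
    · simpa using h p hp (Finset.map_subset_map.1 hS)
    · exact absurd ⟨h, A, hA, Finset.map_subset_map.1 hS⟩ hS'

theorem eq_insertNone_or_eq_map_some (S : Finset (Option α)) :
    (∃ C : Finset α, S = Finset.insertNone C) ∨
      ∃ C : Finset α, S = C.map Function.Embedding.some := by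
  by_cases h : none ∈ S
  · refine Or.inl ⟨S.eraseNone, ?_⟩
    ext (_ | x) <;> simp [h]
  · refine Or.inr ⟨S.eraseNone, ?_⟩
    ext (_ | x) <;> simp [h]

theorem insertNone_ne_map_some (C D : Finset α) :
    Finset.insertNone C ≠ D.map Function.Embedding.some := by
  intro h
  have : none ∈ D.map Function.Embedding.some := h ▸ Finset.none_mem_insertNone
  simp at this

theorem insertNone_inter [DecidableEq α] (C D : Finset α) :
    Finset.insertNone (C ∩ D) = Finset.insertNone C ∩ Finset.insertNone D := by
  ext (_ | x) <;> simp

theorem map_some_inter_insertNone [DecidableEq α] (C D : Finset α) :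
    C.map Function.Embedding.some ∩ Finset.insertNone D =
      (C ∩ D).map Function.Embedding.some := by
  ext (_ | x) <;> simp

theorem insertNone_inter_map_some [DecidableEq α] (C D : Finset α) :
    Finset.insertNone C ∩ D.map Function.Embedding.some =
      (C ∩ D).map Function.Embedding.some := by
  ext (_ | x) <;> simp

theorem insertNone_univ [Fintype α] :
    Finset.insertNone (Finset.univ : Finset α) = Finset.univ := by
  ext (_ | x) <;> simp

theorem not_transGen_addSink_none (y : Option α) :
    ¬ Relation.TransGen (T.addSink Bm).Arc none y := by
  have h : ∀ y, ¬ (T.addSink Bm).Arc none y := by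
    rintro y ⟨A, ⟨p, -, hp⟩ | ⟨B, -, hB⟩, hA⟩
    · obtain rfl : A = _ := (Prod.ext_iff.1 hp).1
      simp at hA
    · obtain rfl : A = _ := (Prod.ext_iff.1 hB).1
      simp at hA
  intro hy
  obtain ⟨z, hz, -⟩ := Relation.TransGen.head'_iff.1 hy
  exact h z hz

/-- No arc leaves the sink, so a walk between old elements never passes through it. -/
theorem transGen_of_transGen_addSink {x y : α}
    (h : Relation.TransGen (T.addSink Bm).Arc (some x) (some y)) :
    Relation.TransGen T.Arc x y := by
  have arc : ∀ {x y : α}, (T.addSink Bm).Arc (some x) (some y) → T.Arc x y := by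
    rintro x y ⟨A, ⟨p, hp, hA⟩ | ⟨B, -, hB⟩, hx⟩
    · obtain ⟨h1, h2⟩ := Prod.ext_iff.1 hA
      obtain rfl : y = p.2 := Option.some_injective _ h2
      replace h1 : A = _ := h1
      rw [h1] at hx
      exact ⟨p.1, hp, by simpa using hx⟩
    · exact absurd (Prod.ext_iff.1 hB).2 (Option.some_ne_none y)
  have main : ∀ z : Option α, Relation.TransGen (T.addSink Bm).Arc (some x) z →
      ∀ y, z = some y → Relation.TransGen T.Arc x y := by
    intro z hz
    induction hz with
    | single hz => rintro y rfl; exact .single (arc hz)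
    | @tail w z hw hz ih =>
      rintro y rfl
      cases w with
      | none => exact absurd (.single hz) (T.not_transGen_addSink_none Bm _)
      | some w => exact .tail (ih w rfl) (arc hz)
  exact main _ h y rfl

theorem IsAcyclic.addSink {T : ImplBase α} (h : T.IsAcyclic) (Bm : Set (Finset α)) :
    (T.addSink Bm).IsAcyclic := by
  rintro (_ | x) hx
  · exact T.not_transGen_addSink_none Bm _ hx
  · exact h x (T.transGen_of_transGen_addSink Bm hx)

/-- The closed sets with a sink depend on the base only through its closed sets. This permits
replacing a cyclic base by an equivalent acyclic one. -/
theorem closedSets_addSink_congr {T T' : ImplBase α} (h : T'.closedSets = T.closedSets)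
    (Bm : Set (Finset α)) : (T'.addSink Bm).closedSets = (T.addSink Bm).closedSets := by
  ext S
  rcases eq_insertNone_or_eq_map_some S with ⟨C, rfl⟩ | ⟨C, rfl⟩
  · rw [insertNone_mem_closedSets_addSink, insertNone_mem_closedSets_addSink, h]
  · rw [map_some_mem_closedSets_addSink, map_some_mem_closedSets_addSink, upFilter, upFilter, h]

variable [Fintype α]

/-- Duality says that the ideal of `Bp` is the complement of the filter, and an antichain is the set
of maximal elements of its ideal. Conversely, by finiteness every closed set outside the filter lies
below a maximal one. -/
theorem areDual_iff_maximal {Bp : Set (Finset α)} (hp : T.IsAntichainOf Bp) :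
    T.AreDual Bp Bm ↔
      ∀ S, Maximal (fun C => C ∈ T.closedSets ∧ C ∉ T.upFilter Bm) S ↔ S ∈ Bp := by
  constructor
  · rintro ⟨h1, h2⟩ S
    have key : ∀ C, (C ∈ T.closedSets ∧ C ∉ T.upFilter Bm) ↔ C ∈ T.ideal Bp := by
      intro C
      constructor
      · rintro ⟨hC, hC'⟩
        rw [← h2] at hC
        exact hC.resolve_right hC'
      · intro hC
        refine ⟨hC.1, fun hC' => ?_⟩
        have : C ∈ T.ideal Bp ∩ T.upFilter Bm := ⟨hC, hC'⟩
        rw [h1] at this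
        exact this
    simp only [key]
    constructor
    · rintro ⟨⟨hS, B, hB, hSB⟩, hmax⟩
      have : B ⊆ S := hmax ⟨hp.1 hB, B, hB, subset_rfl⟩ hSB
      exact (hSB.antisymm this) ▸ hB
    · intro hS
      refine ⟨⟨hp.1 hS, S, hS, subset_rfl⟩, ?_⟩
      rintro C ⟨-, B, hB, hCB⟩ (hSC : S ⊆ C)
      rw [hp.2.eq hS hB (hSC.trans hCB)]
      exact hCB
  · intro h
    constructor
    · rw [Set.eq_empty_iff_forall_notMem]
      rintro C ⟨⟨hC, B, hB, hCB⟩, ⟨-, A, hA, hAC⟩⟩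
      have hB' := ((h B).2 hB).1
      exact hB'.2 ⟨hB'.1, A, hA, hAC.trans hCB⟩
    · refine Set.Subset.antisymm ?_ ?_
      · rintro C (hC | hC)
        exacts [hC.1, hC.1]
      · intro C hC
        by_cases hC' : C ∈ T.upFilter Bm
        · exact Or.inr hC'
        · obtain ⟨B, hCB, hB⟩ := Set.Finite.exists_le_maximal
            (s := {C | C ∈ T.closedSets ∧ C ∉ T.upFilter Bm}) (Set.toFinite _) ⟨hC, hC'⟩
          exact Or.inl ⟨hC, B, (h B).1 hB, hCB⟩

variable [DecidableEq α]

/-- An intersection contains the sink only if both factors do, and the closed sets containing it are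
a copy of the original closure system. -/
theorem insertNone_mem_meetIrreducibles_addSink {S : Finset α} :
    Finset.insertNone S ∈ (T.addSink Bm).meetIrreducibles ↔ S ∈ T.meetIrreducibles := by
  rw [meetIrreducibles, Set.mem_ofPred_eq, insertNone_mem_closedSets_addSink, meetIrreducibles,
    Set.mem_ofPred_eq, ← insertNone_univ, Finset.insertNone.injective.ne_iff]
  refine and_congr_right fun _ => and_congr_right fun _ => ⟨fun h C hC D hD hS => ?_,
    fun h C hC D hD hS => ?_⟩
  · have := h _ ((T.insertNone_mem_closedSets_addSink Bm).2 hC) _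
      ((T.insertNone_mem_closedSets_addSink Bm).2 hD) (by rw [hS, insertNone_inter])
    rwa [Finset.insertNone.injective.eq_iff, Finset.insertNone.injective.eq_iff] at this
  · rcases eq_insertNone_or_eq_map_some C with ⟨C, rfl⟩ | ⟨C, rfl⟩ <;>
      rcases eq_insertNone_or_eq_map_some D with ⟨D, rfl⟩ | ⟨D, rfl⟩
    · rw [← insertNone_inter, Finset.insertNone.injective.eq_iff] at hS
      rw [insertNone_mem_closedSets_addSink] at hC hD
      rw [Finset.insertNone.injective.eq_iff, Finset.insertNone.injective.eq_iff]
      exact h C hC D hD hS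
    · rw [insertNone_inter_map_some] at hS
      exact absurd hS (insertNone_ne_map_some _ _)
    · rw [map_some_inter_insertNone] at hS
      exact absurd hS (insertNone_ne_map_some _ _)
    · rw [← Finset.map_inter] at hS
      exact absurd hS (insertNone_ne_map_some _ _)

/-- The meet-irreducible sets that avoid the sink are the maximal closed sets outside the filter. -/
theorem map_some_mem_meetIrreducibles_addSink {S : Finset α} :
    S.map Function.Embedding.some ∈ (T.addSink Bm).meetIrreducibles ↔
      Maximal (fun C => C ∈ T.closedSets ∧ C ∉ T.upFilter Bm) S := by
  rw [meetIrreducibles, Set.mem_ofPred_eq, map_some_mem_closedSets_addSink, Maximal]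
  refine and_congr_right fun hS => ⟨fun ⟨_, h⟩ C hC hSC => ?_, fun h => ⟨?_, ?_⟩⟩
  -- For `S ⊆ C`, write `S = C ∩ (S ∪ {z})`; the second factor differs from `S`, so `C = S`.
  · rcases h (C.map Function.Embedding.some) ((T.map_some_mem_closedSets_addSink Bm).2 hC)
      (Finset.insertNone S) ((T.insertNone_mem_closedSets_addSink Bm).2 hS.1)
      (by rw [map_some_inter_insertNone, Finset.inter_eq_right.2 hSC]) with h | h
    · rw [Finset.map_inj] at h
      exact h.le
    · exact absurd h (insertNone_ne_map_some _ _)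
  · rw [← insertNone_univ]
    exact (insertNone_ne_map_some _ _).symm
  · intro C hC D hD hCD
    -- Some factor avoids the sink; it is then outside the filter and contains `S`, so maximality
    -- applies.
    rcases eq_insertNone_or_eq_map_some C with ⟨C, rfl⟩ | ⟨C, rfl⟩
    · rcases eq_insertNone_or_eq_map_some D with ⟨D, rfl⟩ | ⟨D, rfl⟩
      · rw [← insertNone_inter] at hCD
        exact absurd hCD.symm (insertNone_ne_map_some _ _)
      · right
        rw [insertNone_inter_map_some, Finset.map_inj] at hCD
        rw [map_some_mem_closedSets_addSink] at hD
        have hSD : S ⊆ D := hCD ▸ Finset.inter_subset_right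
        rw [(h hD hSD).antisymm hSD]
    · left
      rw [map_some_mem_closedSets_addSink] at hC
      have hSC : S ⊆ C := by
        rw [← Finset.map_subset_map (f := Function.Embedding.some), hCD]
        exact Finset.inter_subset_left
      rw [(h hC hSC).antisymm hSC]

theorem areDual_iff_meetIrreducibles_addSink {Bp : Set (Finset α)} (hp : T.IsAntichainOf Bp) :
    T.AreDual Bp Bm ↔ (T.addSink Bm).meetIrreducibles =
      Finset.insertNone '' T.meetIrreducibles ∪ Finset.map Function.Embedding.some '' Bp := by
  rw [T.areDual_iff_maximal Bm hp, Set.ext_iff]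
  simp only [← map_some_mem_meetIrreducibles_addSink]
  have hn : ∀ C : Finset α, C.map Function.Embedding.some ∉
      Finset.insertNone '' T.meetIrreducibles := by
    rintro C ⟨D, -, hD⟩
    exact insertNone_ne_map_some _ _ hD
  have hs : ∀ C : Finset α, Finset.insertNone C ∉
      Finset.map Function.Embedding.some '' Bp := by
    rintro C ⟨D, -, hD⟩
    exact insertNone_ne_map_some _ _ hD.symm
  constructor
  · intro h S
    rcases eq_insertNone_or_eq_map_some S with ⟨C, rfl⟩ | ⟨C, rfl⟩
    · rw [insertNone_mem_meetIrreducibles_addSink, Set.mem_union, or_iff_left (hs C),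
        Finset.insertNone.injective.mem_set_image]
    · rw [h, Set.mem_union, or_iff_right (hn C), (Finset.map_injective _).mem_set_image]
  · intro h C
    rw [h, Set.mem_union, or_iff_right (hn C), (Finset.map_injective _).mem_set_image]

end AddSink

/-! ### Standard and distributive closure spaces -/

section Distributive

variable [Fintype α] [DecidableEq α] {T : ImplBase α}

theorem closure_singleton_ssubset (hs : T.IsStandard) {x y : α} (hy : y ∈ T.closure {x})
    (hne : y ≠ x) : T.closure {y} ⊂ T.closure {x} := by
  have h : T.closure {y} ⊆ (T.closure {x}).erase x :=
    T.closure_singleton_subset (hs.2 x) (Finset.mem_erase.2 ⟨hne, hy⟩)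
  exact Finset.ssubset_of_subset_of_ssubset h (Finset.erase_ssubset (T.self_mem_closure x))

theorem closure_union_closure (S S' : Finset α) :
    T.closure (T.closure S ∪ T.closure S') = T.closure (S ∪ S') := by
  apply Finset.Subset.antisymm
  · exact T.closure_subset (T.closure_mem_closedSets _) (Finset.union_subset
      (T.closure_mono Finset.subset_union_left) (T.closure_mono Finset.subset_union_right))
  · exact T.closure_mono (Finset.union_subset_union (T.subset_closure _) (T.subset_closure _))

/-- Distributivity makes `φ(b)` join-prime. If `b` lies in neither `φ(a)` nor `φ(A)`, both meets
with `φ(b)` sit inside `φ(b) ∖ {b}`, which is closed by standardness; so their join misses `b`. -/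
theorem exists_mem_closure_singleton (hs : T.IsStandard) (hd : T.IsDistributive) {b : α}
    {A : Finset α} (hb : b ∈ T.closure A) : ∃ a ∈ A, b ∈ T.closure {a} := by
  induction A using Finset.induction_on with
  | empty => simp [hs.1] at hb
  | insert a A _ ih =>
    by_contra! hcon
    have ha : b ∉ T.closure {a} := hcon a (Finset.mem_insert_self a A)
    have hA : b ∉ T.closure A := fun h =>
      (ih h).elim fun x hx => hcon x (Finset.mem_insert_of_mem hx.1) hx.2
    have h1 : b ∈ T.closure {b} ∩ T.closure (T.closure {a} ∪ T.closure A) := by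
      rw [closure_union_closure, ← Finset.insert_eq]
      exact Finset.mem_inter.2 ⟨T.self_mem_closure b, hb⟩
    rw [hd _ (T.closure_mem_closedSets _) _ (T.closure_mem_closedSets _) _
      (T.closure_mem_closedSets _)] at h1
    have h2 : (T.closure {b} ∩ T.closure {a}) ∪ (T.closure {b} ∩ T.closure A) ⊆
        (T.closure {b}).erase b := by
      intro x hx
      rw [← Finset.inter_union_distrib_left, Finset.mem_inter, Finset.mem_union] at hx
      refine Finset.mem_erase.2 ⟨?_, hx.1⟩
      rintro rfl
      exact hx.2.elim ha hA
    exact Finset.notMem_erase b _ (T.closure_subset (hs.2 b) h2 h1)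

/-- The closed sets are the down-sets of the order `y ≤ x ↔ y ∈ φ(x)`. -/
theorem mem_closedSets_iff (hs : T.IsStandard) (hd : T.IsDistributive) {S : Finset α} :
    S ∈ T.closedSets ↔ ∀ x ∈ S, T.closure {x} ⊆ S := by
  refine ⟨fun h x hx => T.closure_singleton_subset h hx, fun h p hp hS => ?_⟩
  obtain ⟨a, ha, hb⟩ := exists_mem_closure_singleton hs hd
    (T.closure_mem_closedSets p.1 p hp (T.subset_closure _))
  exact h a (hS ha) hb

/-- The base of the implications with one premise that hold in the closure space. -/
def unary (T : ImplBase α) : ImplBase α :=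
  {p | ∃ x, p.1 = {x} ∧ p.2 ∈ T.closure {x} ∧ p.2 ≠ x}

theorem closedSets_unary (hs : T.IsStandard) (hd : T.IsDistributive) :
    T.unary.closedSets = T.closedSets := by
  ext S
  rw [mem_closedSets_iff hs hd]
  constructor
  · intro h x hx y hy
    by_cases hxy : y = x
    · exact hxy ▸ hx
    · exact h ({x}, y) ⟨x, rfl, hy, hxy⟩ (Finset.singleton_subset_iff.2 hx)
  · rintro h ⟨A, b⟩ ⟨x, rfl, hb, -⟩ hS
    exact h x (Finset.singleton_subset_iff.1 hS) hb

/-- Along each arc the closure of the singleton strictly shrinks. -/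
theorem isAcyclic_unary (hs : T.IsStandard) : T.unary.IsAcyclic := by
  intro x hx
  have h : ∀ y, Relation.TransGen T.unary.Arc x y → T.closure {y} ⊂ T.closure {x} := by
    have arc : ∀ {x y}, T.unary.Arc x y → T.closure {y} ⊂ T.closure {x} := by
      rintro x y ⟨A, ⟨z, rfl, hy, hne⟩, hx⟩
      obtain rfl := Finset.mem_singleton.1 hx
      exact closure_singleton_ssubset hs hy hne
    intro y hy
    induction hy with
    | single h => exact arc h
    | tail _ h ih => exact (arc h).trans ih
  exact (h x hx).ne rfl

/-- The largest closed set that does not contain `x`, in a distributive closure space. -/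
noncomputable def avoid (T : ImplBase α) (x : α) : Finset α :=
  Finset.univ.filter fun y => x ∉ T.closure {y}

theorem mem_avoid {x y : α} : y ∈ T.avoid x ↔ x ∉ T.closure {y} := by
  simp [avoid]

theorem avoid_mem_closedSets (hs : T.IsStandard) (hd : T.IsDistributive) (x : α) :
    T.avoid x ∈ T.closedSets := by
  rw [mem_closedSets_iff hs hd]
  intro y hy z hz
  rw [mem_avoid] at hy ⊢
  exact fun h => hy (T.closure_singleton_subset (T.closure_mem_closedSets _) hz h)

theorem subset_avoid {x : α} {C : Finset α} (hC : C ∈ T.closedSets) (hx : x ∉ C) :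
    C ⊆ T.avoid x :=
  fun _ hy => mem_avoid.2 fun h => hx (T.closure_singleton_subset hC hy h)

/-- `avoid x` is the largest closed set omitting `x`, and an element missing from an intersection is
missing from a factor; hence it is irreducible. Conversely, a proper closed `M` extends to a closed
`M ∪ {x}`, and `M = (M ∪ {x}) ∩ avoid x`. -/
theorem meetIrreducibles_eq_range_avoid (hs : T.IsStandard) (hd : T.IsDistributive) :
    T.meetIrreducibles = Set.range T.avoid := by
  have hself : ∀ x, x ∉ T.avoid x := fun x h => mem_avoid.1 h (T.self_mem_closure x)
  ext M
  constructor
  · rintro ⟨hM, hne, hirr⟩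
    -- Choosing `x` outside `M` with smallest closure forces `φ(x) ∖ {x} ⊆ M`.
    obtain ⟨x, hx, hmin⟩ := Finset.exists_min_image (Finset.univ \ M)
      (fun x => (T.closure {x}).card)
      (by rwa [Finset.sdiff_nonempty, Finset.univ_subset_iff])
    replace hx : x ∉ M := (Finset.mem_sdiff.1 hx).2
    have hcl : insert x M ∈ T.closedSets := by
      rw [mem_closedSets_iff hs hd]
      intro y hy z hz
      rw [Finset.mem_insert] at hy ⊢
      rcases hy with rfl | hy
      · by_contra! hcon
        have h1 := hmin z (by simpa using hcon.2)
        have h2 := Finset.card_lt_card (closure_singleton_ssubset hs hz hcon.1)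
        omega
      · exact Or.inr (T.closure_singleton_subset hM hy hz)
    have hMe : M = insert x M ∩ T.avoid x := by
      rw [Finset.insert_inter_of_notMem (hself x), Finset.inter_eq_left.2 (subset_avoid hM hx)]
    rcases hirr _ hcl _ (avoid_mem_closedSets hs hd x) hMe with h | h
    · exact absurd (h ▸ Finset.mem_insert_self x M) hx
    · exact ⟨x, h⟩
  · rintro ⟨x, rfl⟩
    refine ⟨avoid_mem_closedSets hs hd x, fun h => hself x (h ▸ Finset.mem_univ x), ?_⟩
    intro C hC D hD h
    have hx := hself x
    rw [h, Finset.mem_inter, not_and_or] at hx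
    rcases hx with hx | hx
    · exact Or.inl ((subset_avoid hC hx).antisymm (h ▸ Finset.inter_subset_left))
    · exact Or.inr ((subset_avoid hD hx).antisymm (h ▸ Finset.inter_subset_right))

theorem empty_mem_closedSets (hs : T.IsStandard) : ∅ ∈ T.closedSets :=
  hs.1 ▸ T.closure_mem_closedSets ∅

/-- Any closed `C ∋ x` with `C ∖ {x}` closed will do, since `φ(x) ∖ {x} = φ(x) ∩ (C ∖ {x})`.
Standardness can thus be checked without computing closures. -/
theorem isStandard_iff : T.IsStandard ↔ ∅ ∈ T.closedSets ∧
    ∀ x, ∃ C ∈ T.closedSets, x ∈ C ∧ C.erase x ∈ T.closedSets := by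
  constructor
  · intro hs
    exact ⟨empty_mem_closedSets hs, fun x => ⟨_, T.closure_mem_closedSets _,
      T.self_mem_closure x, hs.2 x⟩⟩
  · rintro ⟨h0, h⟩
    refine ⟨Finset.subset_empty.1 (T.closure_subset h0 subset_rfl), fun x => ?_⟩
    obtain ⟨C, hC, hx, hCx⟩ := h x
    have : (T.closure {x}).erase x = T.closure {x} ∩ C.erase x := by
      rw [Finset.inter_erase, Finset.inter_eq_left.2 (T.closure_singleton_subset hC hx)]
    rw [this]
    exact T.inter_mem_closedSets (T.closure_mem_closedSets _) hCx

theorem IsStandard.addSink (hs : T.IsStandard) {Bm : Set (Finset α)} (h0 : ∅ ∉ Bm) :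
    (T.addSink Bm).IsStandard := by
  have hempty : ∅ ∈ (T.addSink Bm).closedSets := by
    have : (∅ : Finset α).map Function.Embedding.some ∈ (T.addSink Bm).closedSets := by
      rw [map_some_mem_closedSets_addSink]
      refine ⟨empty_mem_closedSets hs, ?_⟩
      rintro ⟨-, A, hA, hA'⟩
      exact h0 (Finset.subset_empty.1 hA' ▸ hA)
    rwa [Finset.map_empty] at this
  refine isStandard_iff.2 ⟨hempty, ?_⟩
  rintro (_ | x)
  · refine ⟨Finset.insertNone ∅,
      (T.insertNone_mem_closedSets_addSink Bm).2 (empty_mem_closedSets hs), by simp, ?_⟩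
    convert hempty
    ext (_ | y) <;> simp
  · refine ⟨Finset.insertNone (T.closure {x}),
      (T.insertNone_mem_closedSets_addSink Bm).2 (T.closure_mem_closedSets _), ?_, ?_⟩
    · simpa using T.self_mem_closure x
    · have : (Finset.insertNone (T.closure {x})).erase (some x) =
          Finset.insertNone ((T.closure {x}).erase x) := by
        ext (_ | y) <;> simp
      rw [this, insertNone_mem_closedSets_addSink]
      exact hs.2 x

theorem isAcyclicConvexGeometry_addSink (hs : T.IsStandard) (hd : T.IsDistributive)
    {Bm : Set (Finset α)} (h0 : ∅ ∉ Bm) : (T.addSink Bm).IsAcyclicConvexGeometry :=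
  ⟨hs.addSink h0, T.unary.addSink Bm, (isAcyclic_unary hs).addSink Bm,
    closedSets_addSink_congr (closedSets_unary hs hd) Bm⟩

end Distributive

/-! ### Transport along an equivalence -/

section Transport

variable {β : Type*} (e : α ≃ β)

/-- The image of a base under a bijection of the ground sets. -/
def mapEquiv (T : ImplBase α) : ImplBase β :=
  (fun p => (p.1.map e.toEmbedding, e p.2)) '' T

theorem map_mem_closedSets_mapEquiv (T : ImplBase α) {S : Finset α} :
    S.map e.toEmbedding ∈ (T.mapEquiv e).closedSets ↔ S ∈ T.closedSets := by
  constructor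
  · intro h p hp hS
    simpa using h _ ⟨p, hp, rfl⟩ (Finset.map_subset_map.2 hS)
  · rintro h _ ⟨p, hp, rfl⟩ hS
    simpa using h p hp (Finset.map_subset_map.1 hS)

theorem map_equiv_surjective (S : Finset β) : ∃ C : Finset α, C.map e.toEmbedding = S :=
  ⟨S.map e.symm.toEmbedding, by ext; simp⟩

theorem isAcyclic_mapEquiv {T : ImplBase α} (h : T.IsAcyclic) : (T.mapEquiv e).IsAcyclic := by
  intro x hx
  refine h (e.symm x) (Relation.TransGen.lift e.symm ?_ x x hx)
  rintro x y ⟨A, ⟨p, hp, hA⟩, hx⟩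
  obtain ⟨rfl, rfl⟩ := Prod.ext_iff.1 hA
  refine ⟨p.1, by simpa using hp, ?_⟩
  simpa using hx

variable [Fintype α] [DecidableEq α] [Fintype β] [DecidableEq β]

theorem isStandard_mapEquiv {T : ImplBase α} (h : T.IsStandard) : (T.mapEquiv e).IsStandard := by
  rw [isStandard_iff] at h ⊢
  refine ⟨?_, fun x => ?_⟩
  · have := (map_mem_closedSets_mapEquiv e T).2 h.1
    rwa [Finset.map_empty] at this
  · obtain ⟨C, hC, hx, hC'⟩ := h.2 (e.symm x)
    refine ⟨_, (map_mem_closedSets_mapEquiv e T).2 hC, by simpa using hx, ?_⟩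
    have := (map_mem_closedSets_mapEquiv e T).2 hC'
    rwa [Finset.map_erase, Equiv.coe_toEmbedding, Equiv.apply_symm_apply] at this

theorem isAcyclicConvexGeometry_mapEquiv {T : ImplBase α} (h : T.IsAcyclicConvexGeometry) :
    (T.mapEquiv e).IsAcyclicConvexGeometry := by
  obtain ⟨hs, T', hT', heq⟩ := h
  refine ⟨isStandard_mapEquiv e hs, T'.mapEquiv e, isAcyclic_mapEquiv e hT', ?_⟩
  ext S
  obtain ⟨C, rfl⟩ := map_equiv_surjective e S
  rw [map_mem_closedSets_mapEquiv, map_mem_closedSets_mapEquiv, heq]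

theorem meetIrreducibles_mapEquiv (T : ImplBase α) :
    (T.mapEquiv e).meetIrreducibles = Finset.map e.toEmbedding '' T.meetIrreducibles := by
  ext S
  obtain ⟨S, rfl⟩ := map_equiv_surjective e S
  rw [(Finset.map_injective _).mem_set_image, meetIrreducibles, Set.mem_ofPred_eq,
    map_mem_closedSets_mapEquiv, meetIrreducibles, Set.mem_ofPred_eq,
    ← Finset.map_univ_equiv e, (Finset.map_injective _).ne_iff]
  refine and_congr_right fun _ => and_congr_right fun _ => ⟨fun h C hC D hD hS => ?_,
    fun h C hC D hD hS => ?_⟩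
  · have := h _ ((map_mem_closedSets_mapEquiv e T).2 hC) _
      ((map_mem_closedSets_mapEquiv e T).2 hD) (by rw [hS, Finset.map_inter])
    rwa [Finset.map_inj, Finset.map_inj] at this
  · obtain ⟨C, rfl⟩ := map_equiv_surjective e C
    obtain ⟨D, rfl⟩ := map_equiv_surjective e D
    rw [← Finset.map_inter, Finset.map_inj] at hS
    rw [map_mem_closedSets_mapEquiv] at hC hD
    rw [Finset.map_inj, Finset.map_inj]
    exact h C hC D hD hS

end Transport

/-! ### Forward chaining -/

section Chain

variable [DecidableEq α]

/-- One round of forward chaining. -/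
def sweep (l : List (Finset α × α)) (S : Finset α) : Finset α :=
  l.foldl (fun S p => if p.1 ⊆ S then insert p.2 S else S) S

theorem subset_sweep (l : List (Finset α × α)) (S : Finset α) : S ⊆ sweep l S := by
  induction l generalizing S with
  | nil => exact subset_rfl
  | cons p l ih =>
    refine Finset.Subset.trans ?_ (ih _)
    dsimp only
    split_ifs
    · exact Finset.subset_insert _ _
    · exact subset_rfl

theorem sweep_subset (l : List (Finset α × α)) {S C : Finset α}
    (hC : C ∈ closedSets ({p | p ∈ l} : ImplBase α)) (h : S ⊆ C) : sweep l S ⊆ C := by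
  have main : ∀ (l' : List (Finset α × α)), (∀ p ∈ l', p ∈ l) → ∀ S, S ⊆ C → sweep l' S ⊆ C := by
    intro l'
    induction l' with
    | nil => exact fun _ _ h => h
    | cons p l' ih =>
      intro hl S hS
      refine ih (fun q hq => hl q (by simp [hq])) _ ?_
      dsimp only
      split_ifs with hp
      · exact Finset.insert_subset (hC p (hl p (by simp)) (hp.trans hS)) hS
      · exact hS
  exact main l (fun _ h => h) S h

theorem closed_of_sweep_eq {l : List (Finset α × α)} {S : Finset α} (h : sweep l S = S) :
    S ∈ closedSets ({p | p ∈ l} : ImplBase α) := by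
  -- A sweep only enlarges its set, so a sweep that ends in `S` tests every implication against `S`
  -- itself.
  have main : ∀ (l' : List (Finset α × α)) (R : Finset α), S ⊆ R → sweep l' R ⊆ S →
      ∀ p ∈ l', p.1 ⊆ S → p.2 ∈ S := by
    intro l'
    induction l' with
    | nil => simp
    | cons q l' ih =>
      intro R hR hS p hp hpS
      have hsub : (if q.1 ⊆ R then insert q.2 R else R) ⊆ S := (subset_sweep l' _).trans hS
      rcases List.mem_cons.1 hp with rfl | hp
      · rw [if_pos (hpS.trans hR)] at hsub
        exact hsub (Finset.mem_insert_self _ _)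
      · refine ih _ ?_ hS p hp hpS
        dsimp only
        split_ifs
        · exact hR.trans (Finset.subset_insert _ _)
        · exact hR
  exact fun p hp => main l S subset_rfl h.le p hp

variable [Fintype α]

/-- Forward chaining computes the closure. -/
theorem iterate_sweep_eq_closure (l : List (Finset α × α)) (S : Finset α) :
    (sweep l)^[Fintype.card α] S = closure ({p | p ∈ l} : ImplBase α) S := by
  set T : ImplBase α := {p | p ∈ l}
  have h1 : ∀ k, S ⊆ (sweep l)^[k] S ∧ (sweep l)^[k] S ⊆ T.closure S := by
    intro k
    induction k with
    | zero => exact ⟨subset_rfl, T.subset_closure S⟩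
    | succ k ih =>
      rw [Function.iterate_succ_apply']
      exact ⟨ih.1.trans (subset_sweep l _), sweep_subset l (T.closure_mem_closedSets S) ih.2⟩
  -- A round that is not yet stable adds an element; after as many rounds as there are elements the
  -- set is stable or everything.
  have h2 : ∀ k, sweep l ((sweep l)^[k] S) = (sweep l)^[k] S ∨ k ≤ ((sweep l)^[k] S).card := by
    intro k
    induction k with
    | zero => exact Or.inr (Nat.zero_le _)
    | succ k ih =>
      rw [Function.iterate_succ_apply']
      by_cases heq : sweep l ((sweep l)^[k] S) = (sweep l)^[k] S
      · exact Or.inl (by rw [heq, heq])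
      · right
        have := Finset.card_lt_card ((subset_sweep l _).ssubset_of_ne (Ne.symm heq))
        have := ih.resolve_left heq
        omega
  have h3 : sweep l ((sweep l)^[Fintype.card α] S) = (sweep l)^[Fintype.card α] S := by
    rcases h2 (Fintype.card α) with h | h
    · exact h
    · have : (sweep l)^[Fintype.card α] S = Finset.univ :=
        Finset.eq_univ_of_card _ (le_antisymm (Finset.card_le_univ _) h)
      rw [this]
      exact Finset.univ_subset_iff.1 (subset_sweep l _)
  exact (h1 _).2.antisymm (T.closure_subset (closed_of_sweep_eq h3) (h1 _).1)

end Chain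

end

end ImplBase

/-! ### The reduction as a feasible function -/

namespace WhileLang

namespace Val

/-- One round of forward chaining on characteristic vectors, the input being that of the
dualization problem. -/
def sweepV (i S : Val) : Val :=
  foldN (part 1 i).len (fun p S => (notSubset (part 0 i) p.hd S).ite S
    (insertV (part 0 i) p.tl S)) (part 1 i) S

/-- The closure of a single element. -/
def closureV (i y : Val) : Val :=
  foldN (part 0 i).len (fun _ S => sweepV i S) (part 0 i) (insertV (part 0 i) y (part 0 i))

/-- The set of the elements whose closure avoids `x`, with the sink added. -/
def avoidV (i x : Val) : Val :=
  cons tt (tabulate (part 0 i) fun y => (lookup (part 0 i) x (closureV i y)).ite nil tt)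

/-- The base with the added sink. -/
def addSinkV (i : Val) : Val :=
  foldN (part 3 i).len (fun A a => cons (cons (cons nil A) nil) a) (part 3 i)
    (foldN (part 1 i).len (fun p a => cons (cons (cons nil p.hd) (cons nil p.tl)) a) (part 1 i) nil)

/-- The candidate family of meet-irreducible elements. -/
def familyV (i : Val) : Val :=
  foldN (part 2 i).len (fun B a => cons (cons nil B) a) (part 2 i) (tabulate (part 0 i) (avoidV i))

/-- The second family contains the empty set. -/
def hasEmptyV (i : Val) : Val :=
  foldN (part 3 i).len (fun A a => (anyV (part 0 i) A).ite a tt) (part 3 i) nil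

/-- The reduction on encodings. If the second family contains the empty set, then the result
encodes an instance with empty ground set. -/
def reduceV (i : Val) : Val :=
  (hasEmptyV i).ite (cons nil (cons nil (cons ((part 2 i).ite tt nil) nil)))
    (cons (cons nil (part 0 i)) (cons (addSinkV i) (cons (familyV i) nil)))

end Val

namespace Feasible

theorem sweepV {S : Val → Val → Val} (hS : Feasible S) :
    Feasible fun i e => Val.sweepV i (S i e) :=
  foldN 1 (F := fun i _ p S => (Val.notSubset (Val.part 0 i) p.hd S).ite S
      (Val.insertV (Val.part 0 i) p.tl S))
    (ite (notSubset (hd (hd (hd env))) (tl (hd env))) (tl (hd env))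
      (insertV (tl (hd (hd env))) (tl (hd env)))) (part 1) hS

theorem closureV {y : Val → Val → Val} (hy : Feasible y) :
    Feasible fun i e => Val.closureV i (y i e) :=
  foldN 0 (F := fun i _ _ S => Val.sweepV i S) (sweepV (tl (hd env))) (part 0)
    (insertV hy (part 0))

theorem avoidV {x : Val → Val → Val} (hx : Feasible x) :
    Feasible fun i e => Val.avoidV i (x i e) :=
  cons tt (tabulate (F := fun i e y =>
      (Val.lookup (Val.part 0 i) (x i e) (Val.closureV i y)).ite Val.nil Val.tt)
    (ite (lookup (comp hx (tl env)) (closureV (hd env))) nil tt))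

theorem addSinkV : Feasible fun i _ => Val.addSinkV i :=
  foldN 3 (F := fun _ _ A a => Val.cons (Val.cons (Val.cons Val.nil A) Val.nil) a)
    (cons (cons (cons nil (hd (hd env))) nil) (tl (hd env))) (part 3)
    (foldN 1 (F := fun _ _ p a =>
        Val.cons (Val.cons (Val.cons Val.nil p.hd) (Val.cons Val.nil p.tl)) a)
      (cons (cons (cons nil (hd (hd (hd env)))) (cons nil (tl (hd (hd env))))) (tl (hd env)))
      (part 1) nil)

theorem familyV : Feasible fun i _ => Val.familyV i :=
  foldN 2 (F := fun _ _ B a => Val.cons (Val.cons Val.nil B) a)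
    (cons (cons nil (hd (hd env))) (tl (hd env))) (part 2)
    (tabulate (F := fun i _ x => Val.avoidV i x) (avoidV (hd env)))

theorem hasEmptyV : Feasible fun i _ => Val.hasEmptyV i :=
  foldN 3 (F := fun i _ A a => (Val.anyV (Val.part 0 i) A).ite a Val.tt)
    (ite (anyV (hd (hd env))) (tl (hd env)) tt) (part 3) nil

theorem reduceV : Feasible fun i _ => Val.reduceV i :=
  ite hasEmptyV (cons nil (cons nil (cons (ite (part 2) tt nil) nil)))
    (cons (cons nil (part 0)) (cons addSinkV (cons familyV nil)))

end Feasible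

namespace Val

/-- Accumulating by `cons` reverses the list, whence the reversals in `sinkBase` and `sinkFamily`.
-/
theorem foldN_cons_ofList (f : Val → Val) (l acc : List Val) :
    foldN (ofList l).len (fun x a => cons (f x) a) (ofList l) (ofList acc) =
      ofList ((l.map f).reverse ++ acc) := by
  rw [len_ofList, foldN_ofList _ _ _ _ le_rfl]
  induction l generalizing acc with
  | nil => rfl
  | cons x l ih =>
    rw [List.map_cons, List.reverse_cons, List.append_assoc]
    exact ih (f x :: acc)

theorem ofBase_eq {n : ℕ} (l : List (Finset (Fin n) × Fin n)) :
    ofBase l = ofList (l.map fun p => cons (ofSet p.1) (ofNat p.2)) := rfl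

theorem ofFamily_eq {n : ℕ} (l : List (Finset (Fin n))) :
    ofFamily l = ofList (l.map ofSet) := rfl

end Val

end WhileLang

/-! ### Correctness of the reduction on encodings -/

namespace DualInput

open WhileLang WhileLang.Val

variable (I : DualInput)

theorem part_zero_enc : part 0 I.enc = ofNat I.n := rfl

theorem part_one_enc : part 1 I.enc = ofBase I.base := rfl

theorem part_two_enc : part 2 I.enc = ofFamily I.pos := rfl

theorem part_three_enc : part 3 I.enc = ofFamily I.neg := rfl

theorem sweepV_enc (S : Finset (Fin I.n)) :
    sweepV I.enc (ofSet S) = ofSet (ImplBase.sweep I.base S) := by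
  rw [sweepV, part_zero_enc, part_one_enc, ofBase_eq, len_ofList, foldN_ofList _ _ _ _ le_rfl,
    ImplBase.sweep]
  induction I.base generalizing S with
  | nil => rfl
  | cons p l ih =>
    rw [List.map_cons, List.foldl_cons, List.foldl_cons, ← ih]
    congr 1
    rw [hd, tl, notSubset_ofSet, ite_ofBool, insertV_ofSet, ite_not]
    split_ifs <;> rfl

theorem closureV_enc (y : Fin I.n) :
    closureV I.enc (ofNat y) = ofSet (I.implBase.closure {y}) := by
  have h : insertV (ofNat I.n) (ofNat y) (ofNat I.n) = ofSet {y} := by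
    rw [← insert_empty_eq, ← insertV_ofSet, ofSet_empty]
  have hk : ∀ (k : ℕ) (S : Finset (Fin I.n)), (fun S => sweepV I.enc S)^[k] (ofSet S) =
      ofSet ((ImplBase.sweep I.base)^[k] S) := by
    intro k
    induction k with
    | zero => exact fun _ => rfl
    | succ k ih =>
      intro S
      rw [Function.iterate_succ_apply, Function.iterate_succ_apply, sweepV_enc, ih]
  rw [closureV, part_zero_enc, len_ofNat, foldN_ofNat _ _ _ _ le_rfl, h, hk, implBase,
    ← ImplBase.iterate_sweep_eq_closure, Fintype.card_fin]

theorem avoidV_enc (x : Fin I.n) :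
    avoidV I.enc (ofNat x) =
      ofSet (insert 0 ((I.implBase.avoid x).map (Fin.succEmb I.n))) := by
  rw [avoidV, part_zero_enc, tabulate_ofNat, ofSet_insert_zero_map_succ, ofSet]
  congr 3
  funext y
  rw [closureV_enc, lookup_ofSet, ite_ofBool]
  by_cases h : x ∈ I.implBase.closure {y} <;> simp [h, ImplBase.mem_avoid, ofBool]

/-- The base with the added sink, on the ground set `Fin (I.n + 1)`; the sink is `0`. -/
def sinkBase : List (Finset (Fin (I.n + 1)) × Fin (I.n + 1)) :=
  (I.neg.map fun A => (A.map (Fin.succEmb I.n), 0)).reverse ++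
    (I.base.map fun p => (p.1.map (Fin.succEmb I.n), p.2.succ)).reverse

/-- The family that has to be compared with the meet-irreducible elements. -/
noncomputable def sinkFamily : List (Finset (Fin (I.n + 1))) :=
  (I.pos.map (Finset.map (Fin.succEmb I.n))).reverse ++
    List.ofFn fun x => insert 0 ((I.implBase.avoid x).map (Fin.succEmb I.n))

theorem addSinkV_enc : addSinkV I.enc = ofBase I.sinkBase := by
  rw [addSinkV, part_one_enc, part_three_enc, ofBase_eq, ofFamily_eq, ofBase_eq,
    show nil = ofList [] from rfl,
    foldN_cons_ofList fun p => cons (cons (ofList []) p.hd) (cons (ofList []) p.tl),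
    foldN_cons_ofList fun A => cons (cons (ofList []) A) (ofList [])]
  simp only [sinkBase, List.map_append, List.map_reverse, List.map_map, List.append_nil]
  congr 3
  · exact List.map_congr_left fun A _ => congrArg (cons · nil) (ofSet_map_succ A).symm
  · refine List.map_congr_left fun p _ => ?_
    simp only [Function.comp_apply, hd, tl, ofSet_map_succ, Fin.val_succ, ofNat_succ]
    rfl

theorem familyV_enc : familyV I.enc = ofFamily I.sinkFamily := by
  rw [familyV, part_zero_enc, part_two_enc, ofFamily_eq, ofFamily_eq, tabulate_ofNat,
    foldN_cons_ofList (cons nil)]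
  simp only [sinkFamily, List.map_append, List.map_reverse, List.map_map, List.map_ofFn]
  congr 3
  · exact List.map_congr_left fun A _ => (ofSet_map_succ A).symm
  · exact funext fun x => I.avoidV_enc x

theorem hasEmptyV_enc : hasEmptyV I.enc = ofBool (decide (∅ ∈ I.neg)) := by
  have h : ∀ (l : List (Finset (Fin I.n))) (b : Bool),
      (l.map ofSet).foldl (fun a A => (anyV (ofNat I.n) A).ite a tt) (ofBool b) =
        ofBool (b || decide (∅ ∈ l)) := by
    intro l
    induction l with
    | nil => simp
    | cons A l ih =>
      intro b
      have : (anyV (ofNat I.n) (ofSet A)).ite (ofBool b) tt = ofBool (b || decide (∅ = A)) := by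
        rw [anyV_ofSet, ite_ofBool]
        by_cases hA : A = ∅
        · simp [hA, ofBool]
        · simp [Finset.nonempty_iff_ne_empty, hA, Ne.symm hA]
      rw [List.map_cons, List.foldl_cons, this, ih]
      simp [Bool.or_assoc]
  rw [hasEmptyV, part_zero_enc, part_three_enc, ofFamily_eq, len_ofList,
    foldN_ofList _ _ _ _ le_rfl]
  exact (h I.neg false).trans (by rw [Bool.false_or])

theorem reduceV_enc_of_notMem (h : ∅ ∉ I.neg) : reduceV I.enc = CMIInput.enc ⟨I.n + 1, I.sinkBase, I.sinkFamily⟩ := by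
  rw [reduceV, hasEmptyV_enc, ite_ofBool, if_neg h, addSinkV_enc, familyV_enc, part_zero_enc,
    ← ofNat_succ]
  rfl

/-- The instance with empty ground set to which a dualization instance is reduced when the second
family contains the empty set. -/
def trivial : CMIInput where
  n := 0
  base := []
  family := if I.pos = [] then [] else [∅]

/-- On the empty ground set `∅` is encoded by `nil`, so `tt` is also the code of the one-member
family `[∅]`. -/
theorem reduceV_enc_of_mem (h : ∅ ∈ I.neg) : reduceV I.enc = I.trivial.enc := by
  rw [reduceV, hasEmptyV_enc, ite_ofBool, if_pos h, part_two_enc, ofFamily_eq]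
  cases hp : I.pos with
  | nil => simp [trivial, hp, CMIInput.enc, ofList, Val.ite, ofBase, ofFamily, ofNat]
  | cons B l => simp [trivial, hp, CMIInput.enc, ofList, Val.ite, ofBase, ofFamily, ofNat, ofSet]

theorem map_some_map_finSuccEquiv_symm {n : ℕ} (A : Finset (Fin n)) :
    (A.map Function.Embedding.some).map (finSuccEquiv n).symm.toEmbedding =
      A.map (Fin.succEmb n) := by
  rw [Finset.map_map]
  rfl

theorem insertNone_map_finSuccEquiv_symm {n : ℕ} (A : Finset (Fin n)) :
    (Finset.insertNone A).map (finSuccEquiv n).symm.toEmbedding =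
      insert 0 (A.map (Fin.succEmb n)) := by
  rw [← map_some_map_finSuccEquiv_symm]
  simp [Finset.insertNone]

theorem setOf_sinkBase : ({p | p ∈ I.sinkBase} : ImplBase (Fin (I.n + 1))) =
    (I.implBase.addSink I.negSets).mapEquiv (finSuccEquiv I.n).symm := by
  ext ⟨A, b⟩
  constructor
  · intro h
    rcases List.mem_append.1 h with h | h
    · obtain ⟨B, hB, heq⟩ := List.mem_map.1 (List.mem_reverse.1 h)
      refine ⟨_, Or.inr ⟨B, hB, rfl⟩, ?_⟩
      rw [← heq]
      simp [map_some_map_finSuccEquiv_symm]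
    · obtain ⟨p, hp, heq⟩ := List.mem_map.1 (List.mem_reverse.1 h)
      refine ⟨_, Or.inl ⟨p, hp, rfl⟩, ?_⟩
      rw [← heq]
      simp [map_some_map_finSuccEquiv_symm]
  · rintro ⟨_, ⟨p, hp, rfl⟩ | ⟨B, hB, rfl⟩, heq⟩
    · refine List.mem_append_right _ (List.mem_reverse.2 (List.mem_map.2 ⟨p, hp, ?_⟩))
      rw [← heq]
      simp [map_some_map_finSuccEquiv_symm]
    · refine List.mem_append_left _ (List.mem_reverse.2 (List.mem_map.2 ⟨B, hB, ?_⟩))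
      rw [← heq]
      simp [map_some_map_finSuccEquiv_symm]

theorem setOf_sinkFamily : {S | S ∈ I.sinkFamily} =
    Finset.map (finSuccEquiv I.n).symm.toEmbedding ''
      (Finset.insertNone '' Set.range I.implBase.avoid ∪
        Finset.map Function.Embedding.some '' I.posSets) := by
  ext S
  rw [Set.image_union, Set.image_image, Set.image_image, ← Set.range_comp]
  simp only [map_some_map_finSuccEquiv_symm]
  rw [Set.mem_ofPred_eq, sinkFamily, List.mem_append, List.mem_reverse, List.mem_map,
    List.mem_ofFn, or_comm]
  refine or_congr ?_ Iff.rfl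
  simp [insertNone_map_finSuccEquiv_symm]

theorem card_le_size_enc : I.n ≤ I.enc.size ∧ I.base.length ≤ I.enc.size ∧
    I.pos.length ≤ I.enc.size ∧ I.neg.length ≤ I.enc.size := by
  have h0 := len_part_le 0 I.enc
  have h1 := len_part_le 1 I.enc
  have h2 := len_part_le 2 I.enc
  have h3 := len_part_le 3 I.enc
  rw [part_zero_enc, len_ofNat] at h0
  rw [part_one_enc, ofBase_eq, len_ofList, List.length_map] at h1
  rw [part_two_enc, ofFamily_eq, len_ofList, List.length_map] at h2
  rw [part_three_enc, ofFamily_eq, len_ofList, List.length_map] at h3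
  exact ⟨h0, h1, h2, h3⟩

/-- The only subset of an empty ground set is the whole set, so there is no meet-irreducible. -/
theorem positive_trivial_iff : I.trivial.sets = I.trivial.implBase.meetIrreducibles ↔
    I.pos = [] := by
  have hm : I.trivial.implBase.meetIrreducibles = ∅ := by
    rw [Set.eq_empty_iff_forall_notMem]
    exact fun M hM => hM.2.1 (Finset.ext fun x => x.elim0)
  have hs : I.trivial.sets = {M | M ∈ if I.pos = [] then [] else [∅]} := rfl
  rw [hm, hs]
  by_cases h : I.pos = [] <;> simp [h, Set.eq_empty_iff_forall_notMem]

theorem admissible_trivial : I.trivial.implBase.IsAcyclicConvexGeometry := by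
  have : IsEmpty (Fin I.trivial.n) := inferInstanceAs (IsEmpty (Fin 0))
  exact ⟨⟨Finset.eq_empty_of_isEmpty _, fun x => isEmptyElim x⟩, _, fun x => isEmptyElim x, rfl⟩

end DualInput

/-! ### The reduction and the theorem -/

/-- The filter is then the whole closure system, which leaves no room for a nonempty ideal. -/
theorem ImplBase.areDual_iff_eq_empty {α : Type*} {T : ImplBase α} {Bp Bm : Set (Finset α)}
    (hp : Bp ⊆ T.closedSets) (h : ∅ ∈ Bm) : T.AreDual Bp Bm ↔ Bp = ∅ := by
  have hup : T.upFilter Bm = T.closedSets :=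
    Set.Subset.antisymm (fun _ hC => hC.1) fun C hC => ⟨hC, ∅, h, Finset.empty_subset C⟩
  constructor
  · rintro ⟨h1, -⟩
    rw [Set.eq_empty_iff_forall_notMem] at h1 ⊢
    exact fun B hB => h1 B ⟨⟨hp hB, B, hB, subset_rfl⟩, hup ▸ hp hB⟩
  · rintro rfl
    have : T.ideal ∅ = ∅ := Set.eq_empty_iff_forall_notMem.2 fun C hC => by
      obtain ⟨-, B, hB, -⟩ := hC
      exact hB
    rw [AreDual, this, hup]
    exact ⟨Set.empty_inter _, Set.empty_union _⟩

open WhileLang in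
/-- Dualization in distributive lattices reduces to the identification of meet-irreducible elements
in acyclic convex geometries. -/
theorem polyTimeSolvable_dualDistributive (h : CMIAcyclic.PolyTimeSolvable) :
    DualDistributive.PolyTimeSolvable := by
  refine h.of_reduction Val.reduceV Feasible.reduceV
    -- The bound `size_enc_le` on `n + 1` elements gives `6 * (n + 1) + 8`; the second factor covers
    -- the four lengths `neg`, `base`, `pos` and `n`.
    ((6 * Polynomial.X + 14) * (4 * Polynomial.X + 2)) ?_
  intro (I : DualInput) ⟨hs, hd, hp, hm⟩
  have hq : ((6 * Polynomial.X + 14) * (4 * Polynomial.X + 2) : Polynomial ℕ).eval I.enc.size =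
      (6 * I.enc.size + 14) * (4 * I.enc.size + 2) := by simp
  by_cases h0 : ∅ ∈ I.neg
  · refine ⟨I.trivial, I.admissible_trivial, (I.reduceV_enc_of_mem h0).symm, ?_, ?_⟩
    · refine (CMIInput.size_enc_le _).trans (le_trans ?_ hq.ge)
      have : I.trivial.family.length ≤ 1 := by
        rw [DualInput.trivial]
        dsimp only
        split_ifs <;> simp
      change (6 * 0 + 8) * (0 + I.trivial.family.length + 1) ≤ _
      nlinarith
    · refine I.positive_trivial_iff.trans ((ImplBase.areDual_iff_eq_empty hp.1 h0).trans ?_).symm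
      rw [Set.eq_empty_iff_forall_notMem, List.eq_nil_iff_forall_not_mem]
      rfl
  · refine ⟨⟨I.n + 1, I.sinkBase, I.sinkFamily⟩, ?_, (I.reduceV_enc_of_notMem h0).symm, ?_, ?_⟩
    · change ImplBase.IsAcyclicConvexGeometry {p | p ∈ I.sinkBase}
      rw [I.setOf_sinkBase]
      exact ImplBase.isAcyclicConvexGeometry_mapEquiv _
        (ImplBase.isAcyclicConvexGeometry_addSink hs hd h0)
    · refine (CMIInput.size_enc_le _).trans (le_trans ?_ hq.ge)
      obtain ⟨h0, h1, h2, h3⟩ := I.card_le_size_enc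
      have hb : I.sinkBase.length = I.neg.length + I.base.length := by simp [DualInput.sinkBase]
      have hf : I.sinkFamily.length = I.pos.length + I.n := by simp [DualInput.sinkFamily]
      dsimp only
      rw [hb, hf]
      exact Nat.mul_le_mul (by omega) (by omega)
    · change {S | S ∈ I.sinkFamily} = ImplBase.meetIrreducibles {p | p ∈ I.sinkBase} ↔
        I.implBase.AreDual _ _
      rw [I.implBase.areDual_iff_meetIrreducibles_addSink _ hp, I.setOf_sinkBase,
        I.setOf_sinkFamily, ImplBase.meetIrreducibles_mapEquiv,
        ImplBase.meetIrreducibles_eq_range_avoid hs hd,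
        (Finset.map_injective _).image_injective.eq_iff, eq_comm]

theorem theorem1 :
    (CMIAcyclic.PolyTimeSolvable → DualDistributive.PolyTimeSolvable) ∧
    (∀ (α : Type) [Fintype α] [DecidableEq α] (T : ImplBase α) (Bp Bm : Set (Finset α)),
      T.IsAntichainOf Bp → T.IsAntichainOf Bm →
        (T.IsAcyclic → (T.addSink Bm).IsAcyclic) ∧
        (T.AreDual Bp Bm ↔
          (T.addSink Bm).meetIrreducibles =
            Finset.insertNone '' T.meetIrreducibles ∪
              Finset.map Function.Embedding.some '' Bp)) :=
  ⟨polyTimeSolvable_dualDistributive, fun _ _ _ T _ Bm hp _ =>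
    ⟨fun h => h.addSink Bm, T.areDual_iff_meetIrreducibles_addSink Bm hp⟩⟩
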